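/- Let $M$ be a compact complex manifold of dimension $n$, $L\to M$ a holomorphic line bundle, $\Omega$ a finite Borel measure on $M$ (for instance a smooth volume form), and $k\ge 0$ an integer such that the holomorphic sections of $L^k$ have no common zero (for instance $L$ ample and $k$ large, in which case the maps $\iota_s$ below are Kodaira embeddings). Put $N+1=\dim H^0(M,L^k)$. For a basis $s=(s_0,\dots,s_N)$ of $H^0(M,L^k)$ let $$\iota_s:M\to\mathbb{CP}^N,\quad \iota_s(p)=[s_0(p):\dots:s_N(p)],\qquad \mu([z])_{\alpha\beta}=\frac{z_\alpha\bar z_\beta}{\sum_i|z_i|^2},\qquad \mu_\Omega(\iota_s)=\int_M\mu(\iota_s(p))\,\Omega(p).$$ Let $\mathcal B=GL(N+1)/U(N+1)$ be the Bergman space, that is, the space of Hermitian inner products $b$ on $H^0(M,L^k)$, and write $\mu_\Omega(b)=\mu_\Omega(\iota_s)$ for a $b$-orthonormal basis $s$; it is defined up to conjugation by a unitary matrix, so its operator norm $\|\mu_\Omega(b)\|_{op}$ (with respect to the Hermitian norm of $\mathbb C^{N+1}$) depends only on $b$. Let $\mathrm{dist}_k$ be the Riemannian distance (infimum of the lengths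 of $C^1$ curves) of the invariant metric on the symmetric space $\mathcal B$ in which the tangent vector at $b$ given by a Hermitian matrix $A$, along which a $b$-orthonormal basis $s$ moves as $e^{tA}s$, has norm $\|A\|=(\mathrm{tr}\,A^2)^{1/2}$; in terms of the Gram matrix $G$ of the inner product in any fixed basis of $H^0(M,L^k)$, the speed of a curve is $\tfrac12\big(\mathrm{tr}\,(G^{-1}\dot G)^2\big)^{1/2}$. Then for any two points $b_0,b_1\in\mathcal B$, $$\|\mu_\Omega(b_1)\|_{op}\le e^{2\,\mathrm{dist}_k(b_0,b_1)}\,\|\mu_\Omega(b_0)\|_{op}.$$ -/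

import Mathlib

open scoped Manifold ContDiff TensorProduct ComplexConjugate LinearAlgebra.Projectivization
open MeasureTheory

noncomputable section

namespace Bergman

section LineBundle

variable {n : ℕ} {M : Type*} [TopologicalSpace M] [ChartedSpace (EuclideanSpace ℂ (Fin n)) M]
  (L : M → Type*) [∀ p, AddCommGroup (L p)] [∀ p, Module ℂ (L p)]
  [TopologicalSpace (Bundle.TotalSpace ℂ L)] [∀ p, TopologicalSpace (L p)]
  [FiberBundle ℂ L] [VectorBundle ℂ ℂ L]

/-- The fibre at `p` of the tensor power `L ^ k` of the line bundle `L`. -/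
abbrev PowFiber (k : ℕ) (p : M) : Type _ := ⨂[ℂ] _ : Fin k, L p

variable {L} in
/-- The coordinate on the fibre of `L ^ k` induced by a local trivialization `e` of `L`:
`v₁ ⊗ ⋯ ⊗ vₖ` is sent to `e v₁ * ⋯ * e vₖ` (for `p` in the base set of `e`). -/
def powCoord (k : ℕ) (e : Bundle.Trivialization ℂ (Bundle.TotalSpace.proj : Bundle.TotalSpace ℂ L → M))
    [MemTrivializationAtlas e] (p : M) : PowFiber L k p →ₗ[ℂ] ℂ :=
  (PiTensorProduct.constantBaseRingEquiv (Fin k) ℂ).toLinearMap ∘ₗ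
    PiTensorProduct.map (fun _ : Fin k => e.linearMapAt ℂ p)

variable {L} in
theorem powCoord_injective (k : ℕ)
    (e : Bundle.Trivialization ℂ (Bundle.TotalSpace.proj : Bundle.TotalSpace ℂ L → M))
    [MemTrivializationAtlas e] {p : M} (hp : p ∈ e.baseSet) :
    Function.Injective (powCoord k e p) := by
  have h : PiTensorProduct.map (fun _ : Fin k => e.linearMapAt ℂ p)
      = (PiTensorProduct.congr (fun _ : Fin k => e.linearEquivAt ℂ p hp)).toLinearMap := by
    ext v
    simp [e.coe_linearMapAt_of_mem hp]
  intro x y hxy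
  simp only [powCoord, h, LinearMap.comp_apply] at hxy
  exact (PiTensorProduct.congr (fun _ : Fin k => e.linearEquivAt ℂ p hp)).injective
    ((PiTensorProduct.constantBaseRingEquiv (Fin k) ℂ).injective hxy)

/-- `H⁰(M, L ^ k)`: the sections of `L ^ k` that are holomorphic in every local trivialization
of the holomorphic line bundle `L`. -/
def H0 (k : ℕ) : Submodule ℂ (∀ p : M, PowFiber L k p) where
  carrier := {s | ∀ (e : Bundle.Trivialization ℂ
      (Bundle.TotalSpace.proj : Bundle.TotalSpace ℂ L → M)) [MemTrivializationAtlas e],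
    MDifferentiableOn 𝓘(ℂ, EuclideanSpace ℂ (Fin n)) 𝓘(ℂ, ℂ)
      (fun p => powCoord k e p (s p)) e.baseSet}
  add_mem' {s t} hs ht e _ := by
    have h : (fun p => powCoord k e p ((s + t) p))
        = (fun p => powCoord k e p (s p)) + fun p => powCoord k e p (t p) := by
      ext p; simp
    rw [h]
    exact (hs e).add (ht e)
  zero_mem' e _ := by
    have h : (fun p => powCoord k e p ((0 : ∀ p : M, PowFiber L k p) p)) = fun _ => (0 : ℂ) := by
      ext p; simp
    rw [h]
    exact mdifferentiableOn_const
  smul_mem' c s hs e _ := by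
    have h : (fun p => powCoord k e p ((c • s) p)) = c • fun p => powCoord k e p (s p) := by
      ext p; simp
    rw [h]
    exact (hs e).const_smul c

/-- `L ^ k` is generated by its global sections: they have no common zero. -/
def GloballyGenerated (k : ℕ) : Prop :=
  ∀ p : M, ∃ s ∈ H0 (n := n) L k, s p ≠ 0

variable {L} in
/-- The homogeneous coordinates `(s₀(p), …, s_N(p))`, read in a local trivialization at `p`. -/
def homCoord {k N : ℕ} (s : Module.Basis (Fin (N + 1)) ℂ (H0 (n := n) L k)) (p : M) :
    Fin (N + 1) → ℂ :=
  fun i => powCoord k (trivializationAt ℂ L p) p ((s i : ∀ p : M, PowFiber L k p) p)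

variable {L} in
theorem homCoord_ne_zero {k N : ℕ} (hL : GloballyGenerated (n := n) L k)
    (s : Module.Basis (Fin (N + 1)) ℂ (H0 (n := n) L k)) (p : M) : homCoord s p ≠ 0 := by
  intro h0
  obtain ⟨t, ht, htp⟩ := hL p
  apply htp
  have hs : ∀ i, (s i : ∀ p : M, PowFiber L k p) p = 0 := fun i =>
    powCoord_injective k (trivializationAt ℂ L p)
      (FiberBundle.mem_baseSet_trivializationAt' p) (by rw [map_zero]; exact congrFun h0 i)
  have hsum := congrArg (fun f : H0 (n := n) L k => (f : ∀ p : M, PowFiber L k p) p)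
    (s.sum_repr ⟨t, ht⟩)
  simp only [Submodule.coe_sum, Submodule.coe_smul, Finset.sum_apply, Pi.smul_apply, hs,
    smul_zero, Finset.sum_const_zero] at hsum
  exact hsum.symm

variable {L} in
/-- The map `ι_s : M → ℂℙᴺ`, `p ↦ [s₀(p) : ⋯ : s_N(p)]`, of a basis `s` of `H⁰(M, L ^ k)`. -/
def kodairaMap {k N : ℕ} (hL : GloballyGenerated (n := n) L k)
    (s : Module.Basis (Fin (N + 1)) ℂ (H0 (n := n) L k)) (p : M) :
    ℙ ℂ (Fin (N + 1) → ℂ) :=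
  Projectivization.mk ℂ (homCoord s p) (homCoord_ne_zero hL s p)

end LineBundle

/-- The moment map `μ([z])_{αβ} = z_α z̄_β / ∑ᵢ |zᵢ|²` of `U(N+1)` acting on `ℂℙᴺ`. -/
def momentMap {N : ℕ} : ℙ ℂ (Fin (N + 1) → ℂ) → Matrix (Fin (N + 1)) (Fin (N + 1)) ℂ :=
  Projectivization.lift
    (fun z => Matrix.of fun α β => z.1 α * conj (z.1 β) / ((∑ i, ‖z.1 i‖ ^ 2 : ℝ) : ℂ))
    (by
      rintro ⟨a, ha⟩ ⟨b, hb⟩ t h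
      simp only at h
      subst h
      have ht : t ≠ 0 := fun h => ha (by simp [h])
      have ht' : (t * conj t : ℂ) ≠ 0 := mul_ne_zero ht (by simpa using ht)
      have hn : ((∑ i, ‖(t • b) i‖ ^ 2 : ℝ) : ℂ)
          = (t * conj t) * ((∑ i, ‖b i‖ ^ 2 : ℝ) : ℂ) := by
        rw [Complex.mul_conj, Complex.normSq_eq_norm_sq]
        push_cast
        simp [mul_pow, Finset.mul_sum]
      ext α β
      simp only [Matrix.of_apply]
      rw [hn, ← mul_div_mul_left (b α * conj (b β)) _ ht']
      congr 1
      simp only [Pi.smul_apply, smul_eq_mul, map_mul]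
      ring)

/-- `μ_Ω(ι) = ∫_M μ(ι(p)) Ω(p)`, entry by entry. -/
def momentIntegral {N : ℕ} {M : Type*} [MeasurableSpace M] (Ω : Measure M)
    (ι : M → ℙ ℂ (Fin (N + 1) → ℂ)) : Matrix (Fin (N + 1)) (Fin (N + 1)) ℂ :=
  Matrix.of fun α β => ∫ p, momentMap (ι p) α β ∂Ω

/-- The operator norm `max |Aζ| / |ζ|` for the Hermitian norm on `ℂᴺ⁺¹`. -/
def opNorm {N : ℕ} (A : Matrix (Fin (N + 1)) (Fin (N + 1)) ℂ) : ℝ :=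
  ‖Matrix.toEuclideanCLM (n := Fin (N + 1)) (𝕜 := ℂ) A‖

section Metrics

variable {V : Type*} [AddCommGroup V] [Module ℂ V] {N : ℕ}

variable (V) in
/-- The Bergman space `GL(N+1) / U(N+1)`, realized as the space of Hermitian inner products on
the `(N+1)`-dimensional space `V` (each one being given by its orthonormal bases, which form one
`U(N+1)`-orbit in the set of all bases). -/
abbrev Space : Type _ := InnerProductSpace.Core ℂ V

/-- The basis `s` is orthonormal for the Hermitian inner product `b`. -/
def IsOrthonormalBasis (b : Space V) (s : Module.Basis (Fin (N + 1)) ℂ V) : Prop :=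
  ∀ i j, b.inner (s i) (s j) = if i = j then 1 else 0

/-- The Gram matrix of the Hermitian inner product `b` in the basis `S`. -/
def gram (S : Module.Basis (Fin (N + 1)) ℂ V) (b : Space V) :
    Matrix (Fin (N + 1)) (Fin (N + 1)) ℂ :=
  Matrix.of fun i j => b.inner (S i) (S j)

/-- The velocity of the curve `γ` at time `t ∈ [0,1]`, as a matrix in the basis `S`. -/
def gramDeriv (S : Module.Basis (Fin (N + 1)) ℂ V) (γ : ℝ → Space V) (t : ℝ) :
    Matrix (Fin (N + 1)) (Fin (N + 1)) ℂ :=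
  Matrix.of fun i j => derivWithin (fun u => gram S (γ u) i j) (Set.Icc 0 1) t

/-- The speed of the curve `γ` for the invariant Riemannian metric of the symmetric space
`GL(N+1) / U(N+1)`: the tangent vector at `b` given by a Hermitian matrix `A`, under which a
`b`-orthonormal basis moves as `exp (t A) · s`, has norm `‖A‖ = (tr A²) ^ (1/2)`. In a
`b`-orthonormal basis the derivative of the Gram matrix is `-2 A` (up to transposition), whence
the factor `1/2`; the expression does not depend on the basis `S`. -/
def speed (S : Module.Basis (Fin (N + 1)) ℂ V) (γ : ℝ → Space V) (t : ℝ) : ℝ :=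
  (1 / 2) * Real.sqrt
    (Matrix.trace (((gram S (γ t))⁻¹ * gramDeriv S γ t) ^ 2)).re

/-- `γ` is a continuously differentiable curve of Hermitian inner products from `b₀` to `b₁`,
parametrized by `[0,1]`. -/
def IsC1Path (S : Module.Basis (Fin (N + 1)) ℂ V) (b₀ b₁ : Space V) (γ : ℝ → Space V) : Prop :=
  γ 0 = b₀ ∧ γ 1 = b₁ ∧ ∀ i j, ContDiffOn ℝ 1 (fun t => gram S (γ t) i j) (Set.Icc 0 1)

/-- The Riemannian distance of the Bergman space: the infimum of the lengths of `C¹` curves.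
The basis `S` serves only to write the metric in coordinates. -/
def dist (S : Module.Basis (Fin (N + 1)) ℂ V) (b₀ b₁ : Space V) : ℝ :=
  sInf {ℓ : ℝ | ∃ γ, IsC1Path S b₀ b₁ γ ∧ ℓ = ∫ t in (0 : ℝ)..1, speed S γ t}

end Metrics

end Bergman

end

/-! In a b-orthonormal basis let w(p) be the unit vector of homogeneous coordinates at p. The moment
matrix is the integral of the projections ww*, so its operator norm m is the maximum of ∫|⟨ζ,w⟩|²
over unit vectors ζ. The core is a one-step estimate m(b') ≥ (1 - δ - O(δ²)) m(b), where δ is the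
Frobenius norm of b' - b in a b-orthonormal basis (`le_max_of_change_of_basis`). Along a C¹ curve δ
is 2·speed·|dt| to first order, and a Gronwall argument (`le_exp_integral_mul`) turns this into the
factor exp(2·length); the infimum over curves is then taken.

For the one-step estimate let C be the change of coordinates, D its inverse and DD* = 1 + X, so that
δ = ‖X‖. If ζ is a maximizer for b, testing b' with D*ζ keeps the pairing, since ⟨D*ζ,Cw⟩ = ⟨ζ,w⟩;
only the lengths of D*ζ and Cw change. To first order this gives m(b')(1 + ⟨X,ζζ*⟩) ≥ m + ⟨X,T⟩ with
T = ∫|⟨ζ,w⟩|² ww*, so what is needed is ‖T - mζζ*‖ ≤ m (`le_integral_norm_inner_sq_mul`).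

The obvious bound ‖T‖ ≤ m only yields √2·m here. The sharper one comes from maximality: put I =
∫|⟨ζ,w⟩|⁴ = ⟨T,ζζ*⟩. Maximality applied to the columns of T gives ∫⟨T,ww*⟩² ≤ m‖T‖², whence ‖T‖² ≤
mI by Cauchy–Schwarz, and ‖T - mζζ*‖² = ‖T‖² - 2mI + m² ≤ m². -/

namespace Bergman

/-! ### Rank one matrices in the Frobenius inner product -/

section RankOne

open scoped InnerProductSpace

variable {ι : Type*} [Fintype ι]

/-- The rank one matrix `w w*`, as a vector of the Euclidean space of all matrices. -/
noncomputable def rankOne (w : EuclideanSpace ℂ ι) : EuclideanSpace ℂ (ι × ι) :=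
  WithLp.toLp 2 fun ij => w ij.1 * conj (w ij.2)

theorem inner_rankOne (u w : EuclideanSpace ℂ ι) :
    ⟪rankOne u, rankOne w⟫_ℂ = ((‖⟪u, w⟫_ℂ‖ ^ 2 : ℝ) : ℂ) := by
  rw [← Complex.normSq_eq_norm_sq, ← Complex.mul_conj]
  simp only [PiLp.inner_apply, rankOne, RCLike.inner_apply, map_sum, Finset.sum_mul_sum,
    Fintype.sum_prod_type, map_mul, RCLike.conj_conj]
  refine Finset.sum_congr rfl fun i _ => Finset.sum_congr rfl fun j _ => ?_
  ring

theorem re_inner_rankOne (u w : EuclideanSpace ℂ ι) :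
    RCLike.re ⟪rankOne u, rankOne w⟫_ℂ = ‖⟪u, w⟫_ℂ‖ ^ 2 := by
  rw [inner_rankOne]; exact Complex.ofReal_re _

theorem norm_rankOne (w : EuclideanSpace ℂ ι) : ‖rankOne w‖ = ‖w‖ ^ 2 := by
  have h := re_inner_rankOne w w
  rw [inner_self_eq_norm_sq, inner_self_eq_norm_sq_to_K] at h
  have h' : ‖rankOne w‖ ^ 2 = (‖w‖ ^ 2) ^ 2 := by
    rw [h]; simp
  exact (sq_eq_sq₀ (norm_nonneg _) (by positivity)).mp h'

/-- The `j`-th column of a matrix given as a vector of the Euclidean space of all matrices. -/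
noncomputable def column (T : EuclideanSpace ℂ (ι × ι)) (j : ι) : EuclideanSpace ℂ ι :=
  WithLp.toLp 2 fun i => T (i, j)

theorem sum_norm_sq_column (T : EuclideanSpace ℂ (ι × ι)) : ∑ j, ‖column T j‖ ^ 2 = ‖T‖ ^ 2 := by
  simp only [EuclideanSpace.norm_sq_eq, column, Fintype.sum_prod_type]
  exact Finset.sum_comm

/-- Cauchy–Schwarz over the columns, the weights w j having total square 1. It reduces a quadratic
expression in a matrix to ones in vectors, to which maximality applies. -/
theorem norm_inner_rankOne_sq_le (T : EuclideanSpace ℂ (ι × ι)) {w : EuclideanSpace ℂ ι}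
    (hw : ‖w‖ = 1) : ‖⟪T, rankOne w⟫_ℂ‖ ^ 2 ≤ ∑ j, ‖⟪column T j, w⟫_ℂ‖ ^ 2 := by
  have h : ⟪T, rankOne w⟫_ℂ = ∑ j, ⟪column T j, w⟫_ℂ * conj (w j) := by
    simp only [PiLp.inner_apply, rankOne, column, RCLike.inner_apply, Finset.sum_mul,
      Fintype.sum_prod_type]
    rw [Finset.sum_comm]
    refine Finset.sum_congr rfl fun i _ => Finset.sum_congr rfl fun j _ => ?_
    ring
  have h1 : ‖⟪T, rankOne w⟫_ℂ‖ ≤ ∑ j, ‖⟪column T j, w⟫_ℂ‖ * ‖w j‖ := by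
    rw [h]
    refine (norm_sum_le _ _).trans (le_of_eq ?_)
    simp
  calc ‖⟪T, rankOne w⟫_ℂ‖ ^ 2 ≤ (∑ j, ‖⟪column T j, w⟫_ℂ‖ * ‖w j‖) ^ 2 := by gcongr
    _ ≤ (∑ j, ‖⟪column T j, w⟫_ℂ‖ ^ 2) * ∑ j, ‖w j‖ ^ 2 := Finset.sum_mul_sq_le_sq_mul_sq _ _ _
    _ = _ := by rw [← EuclideanSpace.norm_sq_eq, hw]; simp

end RankOne

/-! ### The extremal vector and its weighted moment matrix -/

section Extremal

open scoped InnerProductSpace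

variable {ι : Type*} [Fintype ι] {M : Type*} [MeasurableSpace M] {Ω : Measure M}
  [IsFiniteMeasure Ω] {w : M → EuclideanSpace ℂ ι}

/-- Measurability is asked of ww* only: the phase of w depends on the local trivialization chosen at
each point. -/
theorem integrable_inner_rankOne (hw : ∀ p, ‖w p‖ = 1)
    (hm : AEStronglyMeasurable (fun p => rankOne (w p)) Ω) (X : EuclideanSpace ℂ (ι × ι)) :
    Integrable (fun p => RCLike.re ⟪X, rankOne (w p)⟫_ℂ) Ω := by
  have h : Integrable (fun p => rankOne (w p)) Ω :=
    .of_bound hm 1 (.of_forall fun p => by rw [norm_rankOne, hw]; simp)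
  exact (h.const_inner X).re

theorem integrable_norm_inner_sq (hw : ∀ p, ‖w p‖ = 1)
    (hm : AEStronglyMeasurable (fun p => rankOne (w p)) Ω) (u : EuclideanSpace ℂ ι) :
    Integrable (fun p => ‖⟪u, w p⟫_ℂ‖ ^ 2) Ω := by
  simpa only [re_inner_rankOne] using integrable_inner_rankOne hw hm (rankOne u)

theorem norm_inner_sq_le_one {u v : EuclideanSpace ℂ ι} (hu : ‖u‖ = 1) (hv : ‖v‖ = 1) :
    ‖⟪u, v⟫_ℂ‖ ^ 2 ≤ 1 := by
  have h := norm_inner_le_norm (𝕜 := ℂ) u v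
  rw [hu, hv, one_mul] at h
  exact pow_le_one₀ (norm_nonneg _) h

theorem integrable_norm_inner_sq_mul {ζ : EuclideanSpace ℂ ι} (hw : ∀ p, ‖w p‖ = 1)
    (hm : AEStronglyMeasurable (fun p => rankOne (w p)) Ω) (hζ : ‖ζ‖ = 1) {f : M → ℝ}
    (hf : Integrable f Ω) :
    Integrable (fun p => ‖⟪ζ, w p⟫_ℂ‖ ^ 2 * f p) Ω := by
  refine hf.bdd_mul (c := 1) (integrable_norm_inner_sq hw hm ζ).aestronglyMeasurable
    (.of_forall fun p => ?_)
  rw [Real.norm_of_nonneg (by positivity)]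
  exact norm_inner_sq_le_one hζ (hw p)

theorem integral_norm_inner_rankOne_sq_le {m : ℝ} (hw : ∀ p, ‖w p‖ = 1)
    (hm : AEStronglyMeasurable (fun p => rankOne (w p)) Ω)
    (hmax : ∀ u, ∫ p, ‖⟪u, w p⟫_ℂ‖ ^ 2 ∂Ω ≤ m * ‖u‖ ^ 2) (T : EuclideanSpace ℂ (ι × ι)) :
    ∫ p, (RCLike.re ⟪T, rankOne (w p)⟫_ℂ) ^ 2 ∂Ω ≤ m * ‖T‖ ^ 2 := by
  calc ∫ p, (RCLike.re ⟪T, rankOne (w p)⟫_ℂ) ^ 2 ∂Ω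
      ≤ ∫ p, ∑ j, ‖⟪column T j, w p⟫_ℂ‖ ^ 2 ∂Ω := by
        refine integral_mono_of_nonneg (.of_forall fun p => sq_nonneg _)
          (integrable_finsetSum _ fun j _ => integrable_norm_inner_sq hw hm _)
          (.of_forall fun p => ?_)
        refine le_trans ?_ (norm_inner_rankOne_sq_le T (hw p))
        exact (sq_abs (RCLike.re ⟪T, rankOne (w p)⟫_ℂ)).symm.trans_le
          (pow_le_pow_left₀ (abs_nonneg _) (RCLike.abs_re_le_norm _) 2)
    _ = ∑ j, ∫ p, ‖⟪column T j, w p⟫_ℂ‖ ^ 2 ∂Ω :=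
        integral_finsetSum _ fun j _ => integrable_norm_inner_sq hw hm _
    _ ≤ ∑ j, m * ‖column T j‖ ^ 2 := Finset.sum_le_sum fun j _ => hmax _
    _ = m * ‖T‖ ^ 2 := by rw [← Finset.mul_sum, sum_norm_sq_column]

/-- Pairing X with T - mζζ*, whose norm is at most m because ζ is a maximizer. This is where the
constant 2 in the exponent is won. -/
theorem le_integral_norm_inner_sq_mul {m : ℝ} {ζ : EuclideanSpace ℂ ι} (hw : ∀ p, ‖w p‖ = 1)
    (hm : AEStronglyMeasurable (fun p => rankOne (w p)) Ω)
    (hmax : ∀ u, ∫ p, ‖⟪u, w p⟫_ℂ‖ ^ 2 ∂Ω ≤ m * ‖u‖ ^ 2) (hζ : ‖ζ‖ = 1)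
    (hζm : ∫ p, ‖⟪ζ, w p⟫_ℂ‖ ^ 2 ∂Ω = m) (X : EuclideanSpace ℂ (ι × ι)) :
    m * RCLike.re ⟪X, rankOne ζ⟫_ℂ - ‖X‖ * m ≤
      ∫ p, ‖⟪ζ, w p⟫_ℂ‖ ^ 2 * RCLike.re ⟪X, rankOne (w p)⟫_ℂ ∂Ω := by
  have hx := integrable_norm_inner_sq hw hm ζ
  set x : M → ℝ := fun p => ‖⟪ζ, w p⟫_ℂ‖ ^ 2 with hxdef
  have hx0 : ∀ p, 0 ≤ x p := fun p => by positivity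
  have hm0 : 0 ≤ m := hζm ▸ integral_nonneg hx0
  have hxx : Integrable (fun p => x p * x p) Ω := integrable_norm_inner_sq_mul hw hm hζ hx
  have hωn : ∀ p, ‖rankOne (w p)‖ = 1 := fun p => by rw [norm_rankOne, hw]; simp
  have hxω : Integrable (fun p => ((x p : ℝ) : ℂ) • rankOne (w p)) Ω := by
    refine .mono' hx ((Complex.continuous_ofReal.comp_aestronglyMeasurable
      hx.aestronglyMeasurable).smul hm) (.of_forall fun p => ?_)
    rw [norm_smul, hωn, mul_one, Complex.norm_real, Real.norm_of_nonneg (hx0 p)]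
  set T : EuclideanSpace ℂ (ι × ι) := ∫ p, ((x p : ℝ) : ℂ) • rankOne (w p) ∂Ω with hT
  have hTX : ∀ Y, ∫ p, x p * RCLike.re ⟪Y, rankOne (w p)⟫_ℂ ∂Ω = RCLike.re ⟪Y, T⟫_ℂ := by
    intro Y
    rw [hT, ← integral_inner hxω, ← integral_re (hxω.const_inner Y)]
    refine integral_congr_ae (.of_forall fun p => ?_)
    change _ = RCLike.re ⟪Y, ((x p : ℝ) : ℂ) • rankOne (w p)⟫_ℂ
    rw [inner_smul_right]
    exact (RCLike.re_ofReal_mul (K := ℂ) _ _).symm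
  have hTle : ‖T‖ ≤ m := by
    rw [← hζm]
    refine (norm_integral_le_integral_norm _).trans (le_of_eq ?_)
    refine integral_congr_ae (.of_forall fun p => ?_)
    simp only [norm_smul, hωn, mul_one, Complex.norm_real, Real.norm_of_nonneg (hx0 p)]
    rfl
  have hζT : RCLike.re ⟪rankOne ζ, T⟫_ℂ = ∫ p, x p * x p ∂Ω := by
    rw [← hTX]; simp only [re_inner_rankOne, hxdef]
  have hTT : ‖T‖ ^ 2 ≤ m * ∫ p, x p * x p ∂Ω := by
    rcases hm0.eq_or_lt with h0 | hpos
    · have : ‖T‖ = 0 := le_antisymm (hTle.trans h0.symm.le) (norm_nonneg _)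
      rw [this, ← h0]; simp
    have hy := integrable_inner_rankOne hw hm T
    have hyb : ∀ p, ‖RCLike.re ⟪T, rankOne (w p)⟫_ℂ‖ ≤ ‖T‖ := fun p => by
      refine (RCLike.abs_re_le_norm _).trans ((norm_inner_le_norm _ _).trans ?_)
      rw [hωn, mul_one]
    have hyy : Integrable (fun p => (RCLike.re ⟪T, rankOne (w p)⟫_ℂ) ^ 2) Ω := by
      simp only [sq]
      exact hy.bdd_mul hy.aestronglyMeasurable (.of_forall hyb)
    -- Cauchy–Schwarz in the form (mx - y)² ≥ 0 with y = ⟨T,ww*⟩; since ∫xy = ‖T‖² and ∫y² ≤ m‖T‖²,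
    -- it gives ‖T‖² ≤ m∫x².
    have h1 : ∫ p, (2 * m) * (x p * RCLike.re ⟪T, rankOne (w p)⟫_ℂ) ∂Ω ≤
        ∫ p, (m ^ 2 * (x p * x p) + (RCLike.re ⟪T, rankOne (w p)⟫_ℂ) ^ 2) ∂Ω := by
      refine integral_mono ((integrable_norm_inner_sq_mul hw hm hζ hy).const_mul _)
        ((hxx.const_mul _).add hyy) fun p => ?_
      simp only
      nlinarith [sq_nonneg (m * x p - RCLike.re ⟪T, rankOne (w p)⟫_ℂ)]
    rw [integral_const_mul, integral_add (hxx.const_mul _) hyy, integral_const_mul, hTX,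
      inner_self_eq_norm_sq] at h1
    have h2 := integral_norm_inner_rankOne_sq_le hw hm hmax T
    have h3 : m * ‖T‖ ^ 2 ≤ m * (m * ∫ p, x p * x p ∂Ω) := by linarith
    exact le_of_mul_le_mul_left h3 hpos
  have hI : 0 ≤ ∫ p, x p * x p ∂Ω := integral_nonneg fun p => mul_nonneg (hx0 p) (hx0 p)
  have hdist : ‖T - (m : ℂ) • rankOne ζ‖ ≤ m := by
    have h : ‖T - (m : ℂ) • rankOne ζ‖ ^ 2 ≤ m ^ 2 := by
      rw [@norm_sub_sq ℂ, inner_smul_right, norm_smul, norm_rankOne, hζ]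
      have e : RCLike.re ((m : ℂ) * ⟪T, rankOne ζ⟫_ℂ) = m * ∫ p, x p * x p ∂Ω := by
        rw [← hζT, inner_re_symm (rankOne ζ) T]
        simp
      rw [e]
      simp only [Complex.norm_real, Real.norm_of_nonneg hm0]
      nlinarith [mul_nonneg hm0 hI]
    exact (sq_le_sq₀ (norm_nonneg _) hm0).mp h
  rw [hTX]
  have h := (RCLike.abs_re_le_norm ⟪X, T - (m : ℂ) • rankOne ζ⟫_ℂ).trans
    ((norm_inner_le_norm _ _).trans (mul_le_mul_of_nonneg_left hdist (norm_nonneg X)))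
  have h' := (abs_le.mp h).1
  have e : RCLike.re ⟪X, T - (m : ℂ) • rankOne ζ⟫_ℂ
      = RCLike.re ⟪X, T⟫_ℂ - m * RCLike.re ⟪X, rankOne ζ⟫_ℂ := by
    rw [inner_sub_right, inner_smul_right, map_sub]; simp
  linarith

end Extremal

/-! ### Effect of a change of basis on the maximum -/

section Comparison

open scoped InnerProductSpace
open Matrix

variable {ι : Type*} [Fintype ι] [DecidableEq ι]

/-- A matrix as a vector of the Euclidean space of all matrices. -/
noncomputable def matrixVec (X : Matrix ι ι ℂ) : EuclideanSpace ℂ (ι × ι) :=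
  WithLp.toLp 2 fun ij => X ij.1 ij.2

theorem inner_toEuclideanCLM_right (X : Matrix ι ι ℂ) (u v : EuclideanSpace ℂ ι) :
    ⟪u, toEuclideanCLM (n := ι) (𝕜 := ℂ) X v⟫_ℂ
      = ⟪toEuclideanCLM (n := ι) (𝕜 := ℂ) Xᴴ u, v⟫_ℂ := by
  have h : toEuclideanCLM (n := ι) (𝕜 := ℂ) Xᴴ
      = ContinuousLinearMap.adjoint (toEuclideanCLM (n := ι) (𝕜 := ℂ) X) :=
    map_star (toEuclideanCLM (n := ι) (𝕜 := ℂ)) X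
  rw [h, ContinuousLinearMap.adjoint_inner_left]

theorem re_inner_matrixVec_rankOne (X : Matrix ι ι ℂ) (w : EuclideanSpace ℂ ι) :
    RCLike.re ⟪matrixVec X, rankOne w⟫_ℂ
      = RCLike.re ⟪w, toEuclideanCLM (n := ι) (𝕜 := ℂ) X w⟫_ℂ := by
  have h : ⟪matrixVec X, rankOne w⟫_ℂ
      = conj ⟪w, toEuclideanCLM (n := ι) (𝕜 := ℂ) X w⟫_ℂ := by
    simp only [PiLp.inner_apply, rankOne, matrixVec, RCLike.inner_apply, Fintype.sum_prod_type,
      ofLp_toEuclideanCLM, mulVec, dotProduct, map_sum, map_mul, Finset.sum_mul,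
      RCLike.conj_conj]
    refine Finset.sum_congr rfl fun i _ => Finset.sum_congr rfl fun j _ => ?_
    ring
  rw [h, RCLike.conj_re]

theorem norm_toEuclideanCLM_le (X : Matrix ι ι ℂ) (v : EuclideanSpace ℂ ι) :
    ‖toEuclideanCLM (n := ι) (𝕜 := ℂ) X v‖ ≤ ‖matrixVec X‖ * ‖v‖ := by
  refine (sq_le_sq₀ (norm_nonneg _) (by positivity)).mp ?_
  rw [mul_pow]
  simp only [EuclideanSpace.norm_sq_eq, matrixVec, Fintype.sum_prod_type, ofLp_toEuclideanCLM,
    mulVec, dotProduct]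
  rw [Finset.sum_mul]
  refine Finset.sum_le_sum fun i _ => ?_
  calc ‖∑ j, X i j * v j‖ ^ 2 ≤ (∑ j, ‖X i j‖ * ‖v j‖) ^ 2 := by
        gcongr
        exact (norm_sum_le _ _).trans (le_of_eq (by simp))
    _ ≤ _ := Finset.sum_mul_sq_le_sq_mul_sq _ _ _

variable {D C X : Matrix ι ι ℂ}

theorem norm_sq_conjTranspose (hX : D * Dᴴ = 1 + X) (v : EuclideanSpace ℂ ι) :
    ‖toEuclideanCLM (n := ι) (𝕜 := ℂ) Dᴴ v‖ ^ 2
      = ‖v‖ ^ 2 + RCLike.re ⟪matrixVec X, rankOne v⟫_ℂ := by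
  rw [← inner_self_eq_norm_sq (𝕜 := ℂ), inner_toEuclideanCLM_right, conjTranspose_conjTranspose,
    ← mul_apply_eq_comp, ← map_mul, hX, map_add, map_one, _root_.add_apply,
    one_apply_eq_self, inner_add_left, map_add, inner_self_eq_norm_sq,
    re_inner_matrixVec_rankOne, inner_re_symm v]

/-- C*C is the inverse of 1 + X, of norm at most 1/(1 - 1/2) = 2. -/
theorem norm_sq_inverse_le (hDC : D * C = 1) (hX : D * Dᴴ = 1 + X) (hδ : ‖matrixVec X‖ ≤ 1 / 2)
    (v : EuclideanSpace ℂ ι) :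
    ‖toEuclideanCLM (n := ι) (𝕜 := ℂ) C v‖ ^ 2 ≤ 2 * ‖v‖ ^ 2 := by
  set F := toEuclideanCLM (n := ι) (𝕜 := ℂ) with hF
  set u := F (Cᴴ * C) v with hu
  have hDD : D * Dᴴ * (Cᴴ * C) = 1 := by
    rw [Matrix.mul_assoc, ← Matrix.mul_assoc Dᴴ, ← conjTranspose_mul,
      (mul_eq_one_comm.mp hDC : C * D = 1), conjTranspose_one, Matrix.one_mul, hDC]
  have hv : u + F X u = v := by
    have h : F (D * Dᴴ) u = v := by
      rw [hu, ← mul_apply_eq_comp, ← map_mul, hDD, map_one,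
        one_apply_eq_self]
    rw [← h, hX, map_add, map_one, _root_.add_apply, one_apply_eq_self]
  have hle : ‖u‖ ≤ 2 * ‖v‖ := by
    have h1 : ‖F X u‖ ≤ 1 / 2 * ‖u‖ :=
      (norm_toEuclideanCLM_le X u).trans (mul_le_mul_of_nonneg_right hδ (norm_nonneg u))
    have h2 : ‖u‖ ≤ ‖v‖ + ‖F X u‖ := by
      have : u = v - F X u := by rw [← hv]; simp
      calc ‖u‖ = ‖v - F X u‖ := by rw [← this]
        _ ≤ _ := norm_sub_le _ _
    linarith
  have h3 : ‖F C v‖ ^ 2 = RCLike.re ⟪u, v⟫_ℂ := by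
    rw [← inner_self_eq_norm_sq (𝕜 := ℂ), inner_toEuclideanCLM_right, hu, map_mul,
      mul_apply_eq_comp]
  rw [h3]
  have h4 := (RCLike.re_le_norm ⟪u, v⟫_ℂ).trans (norm_inner_le_norm u v)
  nlinarith [norm_nonneg v]

/-- Second-order expansion of (1 + X)⁻¹. Here Cw - D*w = -CXw has square at most 2‖X‖², and in the
expanded square ⟨Cw,D*w⟩ = 1, ‖D*w‖² = 1 + ⟨X,ww*⟩. -/
theorem norm_sq_inverse_le_of_unit (hDC : D * C = 1) (hX : D * Dᴴ = 1 + X)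
    (hδ : ‖matrixVec X‖ ≤ 1 / 2) {w : EuclideanSpace ℂ ι} (hw : ‖w‖ = 1) :
    ‖toEuclideanCLM (n := ι) (𝕜 := ℂ) C w‖ ^ 2
      ≤ 1 - RCLike.re ⟪matrixVec X, rankOne w⟫_ℂ + 2 * ‖matrixVec X‖ ^ 2 := by
  set F := toEuclideanCLM (n := ι) (𝕜 := ℂ) with hF
  have hCD : C * D = 1 := mul_eq_one_comm.mp hDC
  have h1 : F C w - F Dᴴ w = - F C (F X w) := by
    have e : C * (D * Dᴴ) = Dᴴ := by rw [← Matrix.mul_assoc, hCD, Matrix.one_mul]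
    have e2 : F Dᴴ w = F C w + F C (F X w) := by
      rw [← e, hX, Matrix.mul_add, Matrix.mul_one, map_add, map_mul,
        _root_.add_apply, mul_apply_eq_comp]
    rw [e2]; abel
  have h2 : ‖F C w - F Dᴴ w‖ ^ 2 ≤ 2 * ‖matrixVec X‖ ^ 2 := by
    rw [h1, norm_neg]
    refine (norm_sq_inverse_le hDC hX hδ _).trans ?_
    have := norm_toEuclideanCLM_le X w
    rw [hw, mul_one] at this
    gcongr
  have h3 : ⟪F C w, F Dᴴ w⟫_ℂ = ((‖w‖ : ℝ) : ℂ) ^ 2 := by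
    rw [inner_toEuclideanCLM_right, conjTranspose_conjTranspose, ← mul_apply_eq_comp,
      ← map_mul, hDC, map_one, one_apply_eq_self]
    exact inner_self_eq_norm_sq_to_K w
  rw [@norm_sub_sq ℂ, h3, norm_sq_conjTranspose hX, hw] at h2
  simp at h2
  simp only [RCLike.re_to_complex]
  linarith

variable {M : Type*} [MeasurableSpace M] {Ω : Measure M} [IsFiniteMeasure Ω]
  {w w' : M → EuclideanSpace ℂ ι}

theorem le_max_of_change_of_basis {m m' : ℝ} {ζ : EuclideanSpace ℂ ι}
    (hw : ∀ p, ‖w p‖ = 1) (hm : AEStronglyMeasurable (fun p => rankOne (w p)) Ω)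
    (hmax : ∀ u, ∫ p, ‖⟪u, w p⟫_ℂ‖ ^ 2 ∂Ω ≤ m * ‖u‖ ^ 2) (hζ : ‖ζ‖ = 1)
    (hζm : ∫ p, ‖⟪ζ, w p⟫_ℂ‖ ^ 2 ∂Ω = m)
    (hw' : ∀ p, ‖w' p‖ = 1) (hm' : AEStronglyMeasurable (fun p => rankOne (w' p)) Ω)
    (hmax' : ∀ u, ∫ p, ‖⟪u, w' p⟫_ℂ‖ ^ 2 ∂Ω ≤ m' * ‖u‖ ^ 2)
    (hDC : D * C = 1) (hX : D * Dᴴ = 1 + X) (hδ : ‖matrixVec X‖ ≤ 1 / 2)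
    (τ : M → ℂ) (hτ : ∀ p, w' p = τ p • toEuclideanCLM (n := ι) (𝕜 := ℂ) C (w p)) :
    (1 - (‖matrixVec X‖ + 2 * ‖matrixVec X‖ ^ 2) / (1 - ‖matrixVec X‖)) * m ≤ m' := by
  set F := toEuclideanCLM (n := ι) (𝕜 := ℂ) with hF
  set δ := ‖matrixVec X‖ with hδdef
  set ρ := RCLike.re ⟪matrixVec X, rankOne ζ⟫_ℂ with hρ
  have hδ0 : 0 ≤ δ := norm_nonneg _
  have hm0 : 0 ≤ m := hζm ▸ integral_nonneg fun p => by positivity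
  have hx := integrable_norm_inner_sq hw hm ζ
  have hf := integrable_inner_rankOne hw hm (matrixVec X)
  have hxf := integrable_norm_inner_sq_mul hw hm hζ hf
  have hρδ : -δ ≤ ρ := by
    have h := (RCLike.abs_re_le_norm ⟪matrixVec X, rankOne ζ⟫_ℂ).trans (norm_inner_le_norm _ _)
    rw [norm_rankOne, hζ, one_pow, mul_one] at h
    exact (abs_le.mp h).1
  -- The test vector D*ζ cancels C, leaving |τ|²|⟨ζ,w⟩|² with |τ|² = 1/‖Cw‖² ≥ 2 - ‖Cw‖².
  have hpt : ∀ p, (1 - 2 * δ ^ 2) * ‖⟪ζ, w p⟫_ℂ‖ ^ 2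
      + ‖⟪ζ, w p⟫_ℂ‖ ^ 2 * RCLike.re ⟪matrixVec X, rankOne (w p)⟫_ℂ
      ≤ ‖⟪F Dᴴ ζ, w' p⟫_ℂ‖ ^ 2 := by
    intro p
    have e1 : ⟪F Dᴴ ζ, w' p⟫_ℂ = τ p * ⟪ζ, w p⟫_ℂ := by
      rw [hτ, inner_smul_right, ← inner_toEuclideanCLM_right, ← mul_apply_eq_comp,
        ← map_mul, hDC, map_one, one_apply_eq_self]
    have e2 : ‖τ p‖ ^ 2 * ‖F C (w p)‖ ^ 2 = 1 := by
      rw [← mul_pow, ← norm_smul, ← hτ, hw', one_pow]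
    have hq := norm_sq_inverse_le_of_unit hDC hX hδ (hw p)
    have e3 : 2 - ‖F C (w p)‖ ^ 2 ≤ ‖τ p‖ ^ 2 := by
      nlinarith [sq_nonneg (‖F C (w p)‖ ^ 2 - 1), sq_nonneg (‖τ p‖ ^ 2 - 1),
        sq_nonneg (‖F C (w p)‖ - ‖τ p‖), sq_nonneg ‖τ p‖, sq_nonneg ‖F C (w p)‖]
    rw [e1, norm_mul, mul_pow]
    have e4 : 1 - 2 * δ ^ 2 + RCLike.re ⟪matrixVec X, rankOne (w p)⟫_ℂ ≤ ‖τ p‖ ^ 2 := by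
      linarith
    nlinarith [mul_le_mul_of_nonneg_right e4 (sq_nonneg ‖⟪ζ, w p⟫_ℂ‖)]
  have hint : (1 - 2 * δ ^ 2) * m + (m * ρ - δ * m) ≤ m' * (1 + ρ) := by
    have h1 := integral_mono ((hx.const_mul (1 - 2 * δ ^ 2)).add hxf)
      (integrable_norm_inner_sq hw' hm' (F Dᴴ ζ)) hpt
    have h2 := h1.trans (hmax' _)
    rw [norm_sq_conjTranspose hX, hζ, one_pow] at h2
    have h3 := le_integral_norm_inner_sq_mul hw hm hmax hζ hζm (matrixVec X)
    have h4 : ∫ p, ((fun p => (1 - 2 * δ ^ 2) * ‖⟪ζ, w p⟫_ℂ‖ ^ 2 : M → ℝ) + (fun p =>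
        ‖⟪ζ, w p⟫_ℂ‖ ^ 2 * RCLike.re ⟪matrixVec X, rankOne (w p)⟫_ℂ : M → ℝ)) p ∂Ω
        = (1 - 2 * δ ^ 2) * m + ∫ p, ‖⟪ζ, w p⟫_ℂ‖ ^ 2
          * RCLike.re ⟪matrixVec X, rankOne (w p)⟫_ℂ ∂Ω := by
      rw [← hζm, ← integral_const_mul]
      exact integral_add (hx.const_mul _) hxf
    rw [h4] at h2
    linarith
  have hpos : 0 < 1 - δ := by linarith
  have hpos' : 0 < 1 + ρ := by linarith
  -- The terms in ρ cancel up to the common factor 1 + ρ = ‖D*ζ‖², and 1 + ρ ≥ 1 - δ.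
  have key : (1 + ρ) * ((1 - (δ + 2 * δ ^ 2) / (1 - δ)) * m) ≤ (1 + ρ) * m' := by
    have h5 : (δ + 2 * δ ^ 2) ≤ (1 + ρ) * ((δ + 2 * δ ^ 2) / (1 - δ)) := by
      rw [mul_div_assoc', le_div_iff₀ hpos]
      nlinarith [sq_nonneg δ]
    nlinarith [mul_le_mul_of_nonneg_right h5 hm0]
  exact le_of_mul_le_mul_left key hpos'

end Comparison

/-! ### The moment map as a rank one projection -/

section MomentMap

open scoped InnerProductSpace

variable {N : ℕ}

theorem momentMap_mk {z : Fin (N + 1) → ℂ} (hz : z ≠ 0) (α β : Fin (N + 1)) :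
    momentMap (Projectivization.mk ℂ z hz) α β
      = z α * conj (z β) / ((∑ i, ‖z i‖ ^ 2 : ℝ) : ℂ) := rfl

/-- The unit vector in the direction of `z`, for the Hermitian norm. -/
noncomputable def unitVec (z : Fin (N + 1) → ℂ) : EuclideanSpace ℂ (Fin (N + 1)) :=
  ((‖(WithLp.toLp 2 z : EuclideanSpace ℂ (Fin (N + 1)))‖⁻¹ : ℝ) : ℂ) • WithLp.toLp 2 z

theorem norm_toLp_ne_zero {z : Fin (N + 1) → ℂ} (hz : z ≠ 0) :
    ‖(WithLp.toLp 2 z : EuclideanSpace ℂ (Fin (N + 1)))‖ ≠ 0 := by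
  rw [norm_ne_zero_iff]
  exact fun h => hz (by simpa using h)

theorem norm_unitVec {z : Fin (N + 1) → ℂ} (hz : z ≠ 0) : ‖unitVec z‖ = 1 := by
  rw [unitVec, norm_smul, Complex.norm_real, norm_inv, norm_norm,
    inv_mul_cancel₀ (norm_toLp_ne_zero hz)]

theorem rankOne_unitVec {z : Fin (N + 1) → ℂ} (hz : z ≠ 0) :
    rankOne (unitVec z) = matrixVec (momentMap (Projectivization.mk ℂ z hz)) := by
  ext ij
  have h := norm_toLp_ne_zero hz
  have h2 := EuclideanSpace.norm_sq_eq (WithLp.toLp 2 z : EuclideanSpace ℂ (Fin (N + 1)))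
  simp only [rankOne, matrixVec, momentMap_mk, ← h2, unitVec]
  simp only [PiLp.smul_apply, smul_eq_mul, map_mul, Complex.conj_ofReal]
  push_cast
  have h' : ((‖(WithLp.toLp 2 z : EuclideanSpace ℂ (Fin (N + 1)))‖ : ℝ) : ℂ) ≠ 0 := by
    exact_mod_cast h
  field_simp

end MomentMap

/-! ### The operator norm as an attained maximum -/

section OperatorNorm

open scoped InnerProductSpace
open Matrix

variable {N : ℕ} {M : Type*} [MeasurableSpace M] {Ω : Measure M} [IsFiniteMeasure Ω]
  {w : M → EuclideanSpace ℂ (Fin (N + 1))} {ι : M → ℙ ℂ (Fin (N + 1) → ℂ)}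

theorem re_inner_momentIntegral (hw : ∀ p, ‖w p‖ = 1)
    (hm : AEStronglyMeasurable (fun p => rankOne (w p)) Ω)
    (hι : ∀ p, rankOne (w p) = matrixVec (momentMap (ι p)))
    (u : EuclideanSpace ℂ (Fin (N + 1))) :
    RCLike.re ⟪u, toEuclideanCLM (n := Fin (N + 1)) (𝕜 := ℂ) (momentIntegral Ω ι) u⟫_ℂ
      = ∫ p, ‖⟪u, w p⟫_ℂ‖ ^ 2 ∂Ω := by
  have h : Integrable (fun p => rankOne (w p)) Ω :=
    .of_bound hm 1 (.of_forall fun p => by rw [norm_rankOne, hw]; simp)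
  have e : matrixVec (momentIntegral Ω ι) = ∫ p, rankOne (w p) ∂Ω := by
    ext ij
    have h2 := (EuclideanSpace.proj ij : EuclideanSpace ℂ (Fin (N + 1) × Fin (N + 1)) →L[ℂ] ℂ).integral_comp_comm h
    simp only [PiLp.proj_apply] at h2
    rw [← h2]
    simp only [hι]
    rfl
  rw [← re_inner_matrixVec_rankOne, e, inner_re_symm, ← integral_inner h,
    ← integral_re (h.const_inner _)]
  simp only [re_inner_rankOne]

theorem integral_le_opNorm (hw : ∀ p, ‖w p‖ = 1)
    (hm : AEStronglyMeasurable (fun p => rankOne (w p)) Ω)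
    (hι : ∀ p, rankOne (w p) = matrixVec (momentMap (ι p)))
    (u : EuclideanSpace ℂ (Fin (N + 1))) :
    ∫ p, ‖⟪u, w p⟫_ℂ‖ ^ 2 ∂Ω ≤ opNorm (momentIntegral Ω ι) * ‖u‖ ^ 2 := by
  rw [← re_inner_momentIntegral hw hm hι u]
  refine (RCLike.re_le_norm _).trans ((norm_inner_le_norm _ _).trans ?_)
  have := ContinuousLinearMap.le_opNorm
    (toEuclideanCLM (n := Fin (N + 1)) (𝕜 := ℂ) (momentIntegral Ω ι)) u
  calc _ ≤ ‖u‖ * (opNorm (momentIntegral Ω ι) * ‖u‖) := by gcongr; exact this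
    _ = _ := by ring

/-- The moment matrix is Hermitian with nonnegative quadratic form, so its norm is the supremum of
the Rayleigh quotient, attained on the compact unit sphere. -/
theorem exists_integral_eq_opNorm (hw : ∀ p, ‖w p‖ = 1)
    (hm : AEStronglyMeasurable (fun p => rankOne (w p)) Ω)
    (hι : ∀ p, rankOne (w p) = matrixVec (momentMap (ι p))) :
    ∃ ζ : EuclideanSpace ℂ (Fin (N + 1)), ‖ζ‖ = 1 ∧
      ∫ p, ‖⟪ζ, w p⟫_ℂ‖ ^ 2 ∂Ω = opNorm (momentIntegral Ω ι) := by
  set F := toEuclideanCLM (n := Fin (N + 1)) (𝕜 := ℂ) (momentIntegral Ω ι) with hF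
  have hQ := re_inner_momentIntegral hw hm hι
  have hcont : Continuous fun u => RCLike.re ⟪u, F u⟫_ℂ := by fun_prop
  obtain ⟨ζ, hζ, hmax⟩ := (isCompact_sphere (0 : EuclideanSpace ℂ (Fin (N + 1))) 1).exists_isMaxOn
    (NormedSpace.sphere_nonempty.mpr zero_le_one) hcont.continuousOn
  have hζ1 : ‖ζ‖ = 1 := by simpa using hζ
  refine ⟨ζ, hζ1, le_antisymm ?_ ?_⟩
  · simpa [hζ1] using integral_le_opNorm hw hm hι ζ
  have hmom : ∀ (x : ℙ ℂ (Fin (N + 1) → ℂ)) α β, conj (momentMap x α β) = momentMap x β α := by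
    intro x
    induction x using Projectivization.ind with
    | h z hz =>
      intro α β
      simp only [momentMap_mk, map_div₀, map_mul, Complex.conj_conj, Complex.conj_ofReal]
      ring
  have hH : (momentIntegral Ω ι)ᴴ = momentIntegral Ω ι := by
    ext α β
    simp only [conjTranspose_apply, momentIntegral, Matrix.of_apply, RCLike.star_def]
    rw [← integral_conj]
    simp only [hmom]
  have hsymm : F.IsSymmetric := by
    intro u v
    have := inner_toEuclideanCLM_right (momentIntegral Ω ι) u v
    rw [hH] at this
    exact this.symm
  have hn := ContinuousLinearMap.norm_eq_iSup_rayleighQuotient F hsymm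
  rw [opNorm, ← hF, hn, ← hQ]
  refine ciSup_le fun x => ?_
  have hpos : ∀ u, 0 ≤ RCLike.re ⟪u, F u⟫_ℂ := fun u => by
    rw [hQ]; exact integral_nonneg fun p => by positivity
  rw [ContinuousLinearMap.rayleighQuotient, ContinuousLinearMap.reApplyInnerSelf_apply,
    inner_re_symm, abs_of_nonneg (div_nonneg (hpos x) (by positivity))]
  rcases eq_or_ne x 0 with rfl | hx
  · simpa using hpos ζ
  have hx' : ‖x‖ ≠ 0 := norm_ne_zero_iff.mpr hx
  have h1 := hmax (a := ((‖x‖⁻¹ : ℝ) : ℂ) • x) (by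
    simp [norm_smul, hx'])
  refine le_trans (le_of_eq ?_) h1
  simp only [map_smul, inner_smul_left, inner_smul_right, Complex.conj_ofReal, ← mul_assoc,
    ← Complex.ofReal_mul]
  rw [RCLike.re_to_complex, RCLike.re_to_complex, Complex.re_ofReal_mul]
  field_simp

end OperatorNorm

/-- Injectivity forces dimension at most 1. Applied to two coordinates on a fibre of the power of L,
it gives their transition factor. -/
theorem exists_eq_smul_of_injective {V : Type*} [AddCommGroup V] [Module ℂ V] {A B : V →ₗ[ℂ] ℂ}
    (hA : Function.Injective A) (hB : Function.Injective B) : ∃ c : ℂ, c ≠ 0 ∧ ∀ v, A v = c * B v := by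
  by_cases h : ∃ v₀ : V, v₀ ≠ 0
  · obtain ⟨v₀, h0⟩ := h
    have hA0 : A v₀ ≠ 0 := fun h => h0 (hA (by rw [h, map_zero]))
    have hB0 : B v₀ ≠ 0 := fun h => h0 (hB (by rw [h, map_zero]))
    refine ⟨A v₀ / B v₀, div_ne_zero hA0 hB0, fun v => ?_⟩
    have hv : v = (B v / B v₀) • v₀ := hB (by rw [map_smul, smul_eq_mul]; field_simp)
    conv_lhs => rw [hv, map_smul, smul_eq_mul]
    ring
  · push Not at h
    exact ⟨1, one_ne_zero, fun v => by rw [h v]; simp⟩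

/-! ### Continuity of the moment map and change of sections -/

section Geometry

variable {n : ℕ} {M : Type*} [TopologicalSpace M] [ChartedSpace (EuclideanSpace ℂ (Fin n)) M]
  {L : M → Type*} [∀ p, AddCommGroup (L p)] [∀ p, Module ℂ (L p)]
  [TopologicalSpace (Bundle.TotalSpace ℂ L)] [∀ p, TopologicalSpace (L p)]
  [FiberBundle ℂ L] [VectorBundle ℂ ℂ L] {k N : ℕ}

/-- `homCoord` uses a trivialization that varies with p; continuity at p₀ needs one fixed
trivialization on a neighbourhood. The transition factor cancels in the projective point. -/
theorem momentMap_kodairaMap (hL : GloballyGenerated (n := n) L k)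
    (s : Module.Basis (Fin (N + 1)) ℂ (H0 (n := n) L k)) {p₀ p : M}
    (hp : p ∈ (trivializationAt ℂ L p₀).baseSet) (α β : Fin (N + 1)) :
    momentMap (kodairaMap hL s p) α β
      = powCoord k (trivializationAt ℂ L p₀) p ((s α : ∀ p : M, PowFiber L k p) p)
        * conj (powCoord k (trivializationAt ℂ L p₀) p ((s β : ∀ p : M, PowFiber L k p) p))
        / ((∑ i, ‖powCoord k (trivializationAt ℂ L p₀) p
            ((s i : ∀ p : M, PowFiber L k p) p)‖ ^ 2 : ℝ) : ℂ) := by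
  obtain ⟨c, hc, h⟩ := exists_eq_smul_of_injective
    (powCoord_injective k (trivializationAt ℂ L p₀) hp)
    (powCoord_injective k (trivializationAt ℂ L p) (FiberBundle.mem_baseSet_trivializationAt' p))
  have hz : (fun i => powCoord k (trivializationAt ℂ L p₀) p
      ((s i : ∀ p : M, PowFiber L k p) p)) = c • homCoord s p := by
    ext i; exact h _
  have hz0 : (fun i => powCoord k (trivializationAt ℂ L p₀) p
      ((s i : ∀ p : M, PowFiber L k p) p)) ≠ 0 := by
    rw [hz]; exact smul_ne_zero hc (homCoord_ne_zero hL s p)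
  have e : kodairaMap hL s p = Projectivization.mk ℂ _ hz0 := by
    rw [kodairaMap, Projectivization.mk_eq_mk_iff']
    exact ⟨c⁻¹, by rw [hz, smul_smul, inv_mul_cancel₀ hc, one_smul]⟩
  rw [e, momentMap_mk]

theorem continuous_momentMap_kodairaMap (hL : GloballyGenerated (n := n) L k)
    (s : Module.Basis (Fin (N + 1)) ℂ (H0 (n := n) L k)) (α β : Fin (N + 1)) :
    Continuous fun p => momentMap (kodairaMap hL s p) α β := by
  rw [continuous_iff_continuousAt]
  intro p₀
  have hmem := FiberBundle.mem_baseSet_trivializationAt' (F := ℂ) (E := L) p₀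
  have hnhds := (trivializationAt ℂ L p₀).open_baseSet.mem_nhds hmem
  have hf : ∀ i, ContinuousAt (fun p => powCoord k (trivializationAt ℂ L p₀) p
      ((s i : ∀ p : M, PowFiber L k p) p)) p₀ := fun i =>
    ((s i).2 (trivializationAt ℂ L p₀)).continuousOn.continuousAt hnhds
  have hg : ContinuousAt (fun p => powCoord k (trivializationAt ℂ L p₀) p
        ((s α : ∀ p : M, PowFiber L k p) p)
        * conj (powCoord k (trivializationAt ℂ L p₀) p ((s β : ∀ p : M, PowFiber L k p) p))
        / ((∑ i, ‖powCoord k (trivializationAt ℂ L p₀) p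
            ((s i : ∀ p : M, PowFiber L k p) p)‖ ^ 2 : ℝ) : ℂ)) p₀ := by
    refine ContinuousAt.div ((hf α).mul
      (Complex.continuous_conj.continuousAt.comp (hf β))) ?_ ?_
    · exact Complex.continuous_ofReal.continuousAt.comp
        (tendsto_finsetSum _ fun i _ => ((hf i).norm).pow 2)
    · have hpos : 0 < ∑ i, ‖powCoord k (trivializationAt ℂ L p₀) p₀
          ((s i : ∀ p : M, PowFiber L k p) p₀)‖ ^ 2 := by
        obtain ⟨i, hi⟩ := Function.ne_iff.mp (homCoord_ne_zero hL s p₀)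
        exact Finset.sum_pos' (fun _ _ => by positivity)
          ⟨i, Finset.mem_univ _, pow_pos (norm_pos_iff.mpr hi) 2⟩
      exact_mod_cast hpos.ne'
  refine hg.congr ?_
  filter_upwards [hnhds] with p hp using (momentMap_kodairaMap hL s hp α β).symm

theorem rankOne_unitVec_homCoord (hL : GloballyGenerated (n := n) L k)
    (s : Module.Basis (Fin (N + 1)) ℂ (H0 (n := n) L k)) (p : M) :
    rankOne (unitVec (homCoord s p)) = matrixVec (momentMap (kodairaMap hL s p)) :=
  rankOne_unitVec (homCoord_ne_zero hL s p)

theorem aestronglyMeasurable_rankOne [MeasurableSpace M] [BorelSpace M] (Ω : Measure M)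
    (hL : GloballyGenerated (n := n) L k)
    (s : Module.Basis (Fin (N + 1)) ℂ (H0 (n := n) L k)) :
    AEStronglyMeasurable (fun p => rankOne (unitVec (homCoord s p))) Ω := by
  simp only [rankOne_unitVec_homCoord hL]
  refine Continuous.aestronglyMeasurable ?_
  exact (PiLp.continuous_toLp 2 _).comp
    (continuous_pi fun ij => continuous_momentMap_kodairaMap hL s ij.1 ij.2)

open Matrix in
theorem homCoord_toMatrix (s s' : Module.Basis (Fin (N + 1)) ℂ (H0 (n := n) L k)) (p : M) :
    homCoord s' p = (s.toMatrix s')ᵀ *ᵥ homCoord s p := by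
  ext i
  have h := congrArg (fun f : H0 (n := n) L k => powCoord k (trivializationAt ℂ L p) p
    ((f : ∀ p : M, PowFiber L k p) p)) (s.sum_toMatrix_smul_self s' i)
  simp only [Submodule.coe_sum, Submodule.coe_smul, Finset.sum_apply, Pi.smul_apply, map_sum,
    map_smul, smul_eq_mul] at h
  exact h.symm

open Matrix in
theorem exists_unitVec_eq_smul (hL : GloballyGenerated (n := n) L k)
    (s s' : Module.Basis (Fin (N + 1)) ℂ (H0 (n := n) L k)) (p : M) :
    ∃ τ : ℂ, unitVec (homCoord s' p) = τ • toEuclideanCLM (n := Fin (N + 1)) (𝕜 := ℂ)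
      (s.toMatrix s')ᵀ (unitVec (homCoord s p)) := by
  have h : ((‖(WithLp.toLp 2 (homCoord s p) : EuclideanSpace ℂ (Fin (N + 1)))‖ : ℝ) : ℂ) ≠ 0 := by
    exact_mod_cast norm_toLp_ne_zero (homCoord_ne_zero hL s p)
  refine ⟨((‖(WithLp.toLp 2 (homCoord s' p) : EuclideanSpace ℂ (Fin (N + 1)))‖⁻¹ : ℝ) : ℂ)
    * ((‖(WithLp.toLp 2 (homCoord s p) : EuclideanSpace ℂ (Fin (N + 1)))‖ : ℝ) : ℂ), ?_⟩
  rw [unitVec, unitVec, map_smul, toEuclideanCLM_toLp, ← homCoord_toMatrix, smul_smul]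
  push_cast
  rw [mul_assoc, mul_inv_cancel₀ h, mul_one]

end Geometry

/-! ### Gram matrices and the relative distance of inner products -/

section Gram

open Matrix

variable {V : Type*} [AddCommGroup V] [Module ℂ V] {N : ℕ}

theorem exists_isOrthonormalBasis (S : Module.Basis (Fin (N + 1)) ℂ V) (b : Space V) :
    ∃ s : Module.Basis (Fin (N + 1)) ℂ V, IsOrthonormalBasis b s := by
  let := b
  let : NormedAddCommGroup V := InnerProductSpace.Core.toNormedAddCommGroup (𝕜 := ℂ)
  let : InnerProductSpace ℂ V := InnerProductSpace.ofCore b.toCore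
  have : FiniteDimensional ℂ V := S.finiteDimensional_of_finite
  have hr : Module.finrank ℂ V = N + 1 := by simp [Module.finrank_eq_card_basis S]
  let o := (stdOrthonormalBasis ℂ V).reindex (finCongr hr)
  refine ⟨o.toBasis, fun i j => ?_⟩
  have h := orthonormal_iff_ite.mp o.orthonormal i j
  simpa using h

end Gram

section GramChange

open Matrix

variable {V : Type*} [AddCommGroup V] [Module ℂ V] {N : ℕ}

theorem gram_eq_conjTranspose_mul (S s : Module.Basis (Fin (N + 1)) ℂ V) (b : Space V) :
    gram s b = (S.toMatrix s)ᴴ * gram S b * S.toMatrix s := by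
  let := b
  let : NormedAddCommGroup V := InnerProductSpace.Core.toNormedAddCommGroup (𝕜 := ℂ)
  let : InnerProductSpace ℂ V := InnerProductSpace.ofCore b.toCore
  have hb : ∀ x y, b.inner x y = inner ℂ x y := fun _ _ => rfl
  ext i j
  simp only [gram, Matrix.of_apply, hb, Matrix.mul_apply, conjTranspose_apply, Finset.sum_mul]
  conv_lhs => rw [← S.sum_toMatrix_smul_self s i, ← S.sum_toMatrix_smul_self s j]
  simp only [sum_inner, inner_sum, inner_smul_left, inner_smul_right, Finset.mul_sum]
  refine Finset.sum_congr rfl fun k _ => Finset.sum_congr rfl fun l _ => ?_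
  simp only [RCLike.star_def]
  ring

theorem gram_isHermitian (S : Module.Basis (Fin (N + 1)) ℂ V) (b : Space V) :
    (gram S b)ᴴ = gram S b := by
  ext i j
  exact b.conj_inner_symm _ _

theorem IsOrthonormalBasis.gram_eq_one {s : Module.Basis (Fin (N + 1)) ℂ V} {b : Space V}
    (h : IsOrthonormalBasis b s) : gram s b = 1 := by
  ext i j
  rw [Matrix.one_apply]
  exact h i j

theorem IsOrthonormalBasis.gram_mul {s : Module.Basis (Fin (N + 1)) ℂ V} {b : Space V}
    (h : IsOrthonormalBasis b s) (S : Module.Basis (Fin (N + 1)) ℂ V) :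
    S.toMatrix s * (S.toMatrix s)ᴴ * gram S b = 1 := by
  have h1 : (S.toMatrix s)ᴴ * gram S b * S.toMatrix s = 1 := by
    rw [← gram_eq_conjTranspose_mul, h.gram_eq_one]
  rw [Matrix.mul_assoc]
  exact mul_eq_one_comm.mp h1

theorem det_gram_ne_zero (S : Module.Basis (Fin (N + 1)) ℂ V) (b : Space V) :
    (gram S b).det ≠ 0 := by
  obtain ⟨s, hs⟩ := exists_isOrthonormalBasis S b
  exact (Matrix.isUnit_det_of_left_inverse (hs.gram_mul S)).ne_zero

/-- The size of `b' - b` relative to `b`: the Frobenius norm of `b' - b` in a `b`-orthonormal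
basis. -/
noncomputable def relDist (S : Module.Basis (Fin (N + 1)) ℂ V) (b b' : Space V) : ℝ :=
  Real.sqrt (Matrix.trace (((gram S b)⁻¹ * (gram S b' - gram S b)) ^ 2)).re

/-- With P = `S.toMatrix s`, the difference in the basis s is P*(G' - G)P and PP* = G⁻¹; the trace
is cyclic, and tr Y² is the squared Frobenius norm of a Hermitian Y. The transpose does not change
that norm. -/
theorem norm_matrixVec_gram_sub_one (S : Module.Basis (Fin (N + 1)) ℂ V) {b : Space V}
    {s : Module.Basis (Fin (N + 1)) ℂ V} (h : IsOrthonormalBasis b s) (b' : Space V) :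
    ‖matrixVec ((gram s b')ᵀ - 1)‖ = relDist S b b' := by
  have hY : gram s b' - 1 = (S.toMatrix s)ᴴ * (gram S b' - gram S b) * S.toMatrix s := by
    rw [Matrix.mul_sub, Matrix.sub_mul, ← gram_eq_conjTranspose_mul, ← gram_eq_conjTranspose_mul,
      h.gram_eq_one]
  have hYH : (gram s b' - 1)ᴴ = gram s b' - 1 := by
    rw [conjTranspose_sub, gram_isHermitian, conjTranspose_one]
  have hinv : (gram S b)⁻¹ = S.toMatrix s * (S.toMatrix s)ᴴ :=
    Matrix.inv_eq_left_inv (h.gram_mul S)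
  have htr : Matrix.trace (((gram S b)⁻¹ * (gram S b' - gram S b)) ^ 2)
      = Matrix.trace ((gram s b' - 1) * (gram s b' - 1)ᴴ) := by
    rw [hYH, hY, hinv, sq]
    simp only [Matrix.mul_assoc]
    rw [Matrix.trace_mul_comm]
    simp only [Matrix.mul_assoc]
  rw [relDist, htr, eq_comm, Real.sqrt_eq_iff_eq_sq _ (norm_nonneg _), EuclideanSpace.norm_sq_eq]
  · rw [Fintype.sum_prod_type, Finset.sum_comm, Matrix.trace, Complex.re_sum]
    refine Finset.sum_congr rfl fun i _ => ?_
    rw [diag_apply, Matrix.mul_apply, Complex.re_sum]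
    refine Finset.sum_congr rfl fun j _ => ?_
    rw [conjTranspose_apply, RCLike.star_def, Complex.mul_conj, Complex.ofReal_re,
      Complex.normSq_eq_norm_sq]
    simp only [matrixVec, Matrix.sub_apply, transpose_apply, Matrix.one_apply, eq_comm]
  · rw [Matrix.trace, Complex.re_sum]
    refine Finset.sum_nonneg fun i _ => ?_
    rw [diag_apply, Matrix.mul_apply, Complex.re_sum]
    refine Finset.sum_nonneg fun j _ => ?_
    rw [conjTranspose_apply, RCLike.star_def, Complex.mul_conj, Complex.ofReal_re]
    exact Complex.normSq_nonneg _

end GramChange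

/-! ### One-step comparison of moment matrices -/

section Comparison

open Matrix

variable {n : ℕ} {M : Type*} [TopologicalSpace M] [MeasurableSpace M] [BorelSpace M]
  [ChartedSpace (EuclideanSpace ℂ (Fin n)) M] (Ω : Measure M) [IsFiniteMeasure Ω]
  {L : M → Type*} [∀ p, AddCommGroup (L p)] [∀ p, Module ℂ (L p)]
  [TopologicalSpace (Bundle.TotalSpace ℂ L)] [∀ p, TopologicalSpace (L p)]
  [FiberBundle ℂ L] [VectorBundle ℂ ℂ L] {k N : ℕ}

theorem opNorm_momentIntegral_comparison (hL : GloballyGenerated (n := n) L k)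
    (S : Module.Basis (Fin (N + 1)) ℂ (H0 (n := n) L k)) {b b' : Space (H0 (n := n) L k)}
    {s s' : Module.Basis (Fin (N + 1)) ℂ (H0 (n := n) L k)}
    (h : IsOrthonormalBasis b s) (h' : IsOrthonormalBasis b' s') (hδ : relDist S b b' ≤ 1 / 2) :
    (1 - (relDist S b b' + 2 * relDist S b b' ^ 2) / (1 - relDist S b b'))
      * opNorm (momentIntegral Ω (kodairaMap hL s)) ≤
      opNorm (momentIntegral Ω (kodairaMap hL s')) := by
  have hw : ∀ (t : Module.Basis (Fin (N + 1)) ℂ (H0 (n := n) L k)) (p : M),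
      ‖unitVec (homCoord t p)‖ = 1 := fun t p => norm_unitVec (homCoord_ne_zero hL t p)
  have hm := aestronglyMeasurable_rankOne Ω hL s
  have hm' := aestronglyMeasurable_rankOne Ω hL s'
  obtain ⟨ζ, hζ, hζm⟩ := exists_integral_eq_opNorm (hw s) hm (rankOne_unitVec_homCoord hL s)
  choose τ hτ using exists_unitVec_eq_smul hL s s'
  rw [← norm_matrixVec_gram_sub_one S h b'] at hδ ⊢
  refine le_max_of_change_of_basis (D := (s'.toMatrix s)ᵀ) (hw s) hm
    (integral_le_opNorm (hw s) hm (rankOne_unitVec_homCoord hL s)) hζ hζm (hw s') hm'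
    (integral_le_opNorm (hw s') hm' (rankOne_unitVec_homCoord hL s')) ?_ ?_ hδ τ hτ
  · rw [← transpose_mul, s.toMatrix_mul_toMatrix_flip, transpose_one]
  -- The Gram matrix of b' in the basis s is P*P with P = `s'.toMatrix s`; its transpose is DD* for
  -- D = Pᵀ.
  · have e := gram_eq_conjTranspose_mul s' s b'
    rw [h'.gram_eq_one, Matrix.mul_one] at e
    rw [e, transpose_mul, add_sub_cancel]
    rfl

end Comparison

/-! ### A Gronwall inequality from local lower bounds -/

section Gronwall

open Set Filter Topology

/-- Going back from time 1, m decays at relative rate at most σ. No differentiability of m is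
available, so slopes are compared with an explicit barrier; the extra ε in its exponent makes the
derivative inequality strict at contact, where positivity of m 1 enters. -/
theorem le_exp_integral_mul {m σ : ℝ → ℝ} (hm : ContinuousOn m (Icc 0 1)) (hσ : Continuous σ)
    (hpos : 0 < m 1)
    (h : ∀ t ∈ Icc (0 : ℝ) 1, ∀ c, σ t < c →
      ∀ᶠ t' in 𝓝[Icc 0 1] t, (1 - c * |t' - t|) * m t ≤ m t') :
    m 1 ≤ Real.exp (∫ t in (0 : ℝ)..1, σ t) * m 0 := by
  have hσ' : Continuous fun x => σ (1 - x) := by fun_prop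
  have key : ∀ ε > 0, m 1 * Real.exp (-((∫ t in (0 : ℝ)..1, σ t) + ε)) ≤ m 0 := by
    intro ε hε
    have hB : ∀ x, HasDerivAt
        (fun u => -(m 1 * Real.exp (-((∫ t in (0 : ℝ)..u, σ (1 - t)) + ε * u))))
        (m 1 * Real.exp (-((∫ t in (0 : ℝ)..x, σ (1 - t)) + ε * x)) * (σ (1 - x) + ε)) x := by
      intro x
      have h1 : HasDerivAt (fun u => (∫ t in (0 : ℝ)..u, σ (1 - t)) + ε * u)
          (σ (1 - x) + ε) x := by
        have h2 := (hσ'.integral_hasStrictDerivAt 0 x).hasDerivAt.add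
          ((hasDerivAt_id x).const_mul ε)
        rwa [mul_one] at h2
      exact ((h1.neg.exp).const_mul (m 1)).neg.congr_deriv (by simp only [Pi.neg_apply]; ring)
    have hf : ContinuousOn (fun u => - m (1 - u)) (Icc 0 1) :=
      (hm.comp (by fun_prop) fun u hu => ⟨by linarith [hu.2], by linarith [hu.1]⟩).neg
    have := image_le_of_liminf_slope_right_lt_deriv_boundary (f := fun u => - m (1 - u))
      (f' := fun u => σ (1 - u) * m (1 - u)) (a := 0) (b := 1) hf ?_ (by simp) hB ?_
      (right_mem_Icc.mpr zero_le_one)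
    · simp only [sub_self, mul_one] at this
      have e : ∫ t in (0 : ℝ)..1, σ (1 - t) = ∫ t in (0 : ℝ)..1, σ t := by
        simp [intervalIntegral.integral_comp_sub_left]
      rw [e] at this
      linarith
    · intro x hx r hr
      refine Eventually.frequently ?_
      -- A margin above σ small enough that (σ + η)m stays below r.
      set η := (r - σ (1 - x) * m (1 - x)) / (|m (1 - x)| + 1) with hη
      have hden : 0 < |m (1 - x)| + 1 := by positivity
      have hη0 : 0 < η := div_pos (by linarith) hden
      have hηe : η * (|m (1 - x)| + 1) = r - σ (1 - x) * m (1 - x) :=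
        div_mul_cancel₀ _ hden.ne'
      have hlt : (σ (1 - x) + η) * m (1 - x) < r := by
        nlinarith [mul_le_mul_of_nonneg_left (le_abs_self (m (1 - x))) hη0.le]
      have htend : Tendsto (fun z => 1 - z) (𝓝[>] x) (𝓝[Icc 0 1] (1 - x)) := by
        refine tendsto_nhdsWithin_iff.mpr ⟨?_, ?_⟩
        · exact (Continuous.tendsto (by fun_prop) x).mono_left nhdsWithin_le_nhds
        · filter_upwards [Ioo_mem_nhdsGT hx.2] with z hz
          exact ⟨by linarith [hz.2], by linarith [hz.1, hx.1]⟩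
      have hev := htend.eventually (h (1 - x) ⟨by linarith [hx.2], by linarith [hx.1]⟩
        (σ (1 - x) + η) (by linarith))
      filter_upwards [hev, self_mem_nhdsWithin] with z hz hxz
      have hzx : 0 < z - x := sub_pos.mpr hxz
      have habs : |1 - z - (1 - x)| = z - x := by
        rw [show 1 - z - (1 - x) = -(z - x) by ring, abs_neg, abs_of_pos hzx]
      rw [habs] at hz
      rw [slope_def_field, div_lt_iff₀ hzx]
      nlinarith [mul_lt_mul_of_pos_right hlt hzx]
    · intro x _ hfx
      have hE : m (1 - x) = m 1 * Real.exp (-((∫ t in (0 : ℝ)..x, σ (1 - t)) + ε * x)) :=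
        neg_injective hfx
      simp only [← hE]
      have : 0 < m (1 - x) := hE ▸ by positivity
      nlinarith
  have hlim : Tendsto (fun ε => m 1 * Real.exp (-((∫ t in (0 : ℝ)..1, σ t) + ε))) (𝓝[>] 0)
      (𝓝 (m 1 * Real.exp (-((∫ t in (0 : ℝ)..1, σ t) + 0)))) :=
    (Continuous.tendsto (by fun_prop) 0).mono_left nhdsWithin_le_nhds
  have h0 := le_of_tendsto hlim (by filter_upwards [self_mem_nhdsWithin] with ε hε using key ε hε)
  rw [add_zero, Real.exp_neg] at h0
  rw [mul_comm]
  exact (div_le_iff₀ (Real.exp_pos _)).mp h0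

end Gronwall

/-! ### Infinitesimal behaviour along C¹ curves, and their existence -/

section Paths

open Matrix Set Filter Topology

variable {V : Type*} [AddCommGroup V] [Module ℂ V] {N : ℕ}
  {S : Module.Basis (Fin (N + 1)) ℂ V} {b₀ b₁ : Space V} {γ : ℝ → Space V}

theorem relDist_self (S : Module.Basis (Fin (N + 1)) ℂ V) (b : Space V) : relDist S b b = 0 := by
  simp [relDist]

theorem IsC1Path.continuousOn_gram (hγ : IsC1Path S b₀ b₁ γ) :
    ContinuousOn (fun t => gram S (γ t)) (Icc 0 1) :=
  continuousOn_pi.mpr fun i => continuousOn_pi.mpr fun j => (hγ.2.2 i j).continuousOn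

theorem IsC1Path.continuousOn_gram_inv (hγ : IsC1Path S b₀ b₁ γ) :
    ContinuousOn (fun t => (gram S (γ t))⁻¹) (Icc 0 1) := fun t ht =>
  (continuousAt_matrix_inv _ (by
    rw [Ring.inverse_eq_inv']
    exact continuousAt_inv₀ (det_gram_ne_zero S (γ t)))).comp_continuousWithinAt
      (hγ.continuousOn_gram t ht)

theorem IsC1Path.continuousOn_gramDeriv (hγ : IsC1Path S b₀ b₁ γ) :
    ContinuousOn (gramDeriv S γ) (Icc 0 1) :=
  continuousOn_pi.mpr fun i => continuousOn_pi.mpr fun j =>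
    (hγ.2.2 i j).continuousOn_derivWithin (uniqueDiffOn_Icc one_pos) le_rfl

theorem continuous_sqrt_re_trace_sq : Continuous fun A : Matrix (Fin (N + 1)) (Fin (N + 1)) ℂ =>
    Real.sqrt (Matrix.trace (A ^ 2)).re := by
  refine Real.continuous_sqrt.comp (Complex.continuous_re.comp (Continuous.matrix_trace ?_))
  exact continuous_pow 2

theorem IsC1Path.continuousOn_speed (hγ : IsC1Path S b₀ b₁ γ) :
    ContinuousOn (speed S γ) (Icc 0 1) :=
  continuousOn_const.mul (continuous_sqrt_re_trace_sq.comp_continuousOn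
    (hγ.continuousOn_gram_inv.mul hγ.continuousOn_gramDeriv))

theorem IsC1Path.tendsto_relDist_right (hγ : IsC1Path S b₀ b₁ γ) {t : ℝ} (ht : t ∈ Icc (0 : ℝ) 1) :
    Tendsto (fun t' => relDist S (γ t) (γ t')) (𝓝[Icc 0 1] t) (𝓝 0) := by
  have h : ContinuousWithinAt (fun t' => relDist S (γ t) (γ t')) (Icc 0 1) t :=
    continuous_sqrt_re_trace_sq.continuousAt.comp_continuousWithinAt
      (continuousWithinAt_const.mul ((hγ.continuousOn_gram t ht).sub continuousWithinAt_const))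
  have h' := h.tendsto
  rwa [relDist_self] at h'

theorem IsC1Path.tendsto_relDist_left (hγ : IsC1Path S b₀ b₁ γ) {t : ℝ} (ht : t ∈ Icc (0 : ℝ) 1) :
    Tendsto (fun t' => relDist S (γ t') (γ t)) (𝓝[Icc 0 1] t) (𝓝 0) := by
  have h : ContinuousWithinAt (fun t' => relDist S (γ t') (γ t)) (Icc 0 1) t :=
    continuous_sqrt_re_trace_sq.continuousAt.comp_continuousWithinAt
      ((hγ.continuousOn_gram_inv t ht).mul
        (continuousWithinAt_const.sub (hγ.continuousOn_gram t ht)))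
  have h' := h.tendsto
  rwa [relDist_self] at h'

theorem IsC1Path.tendsto_relDist_div (hγ : IsC1Path S b₀ b₁ γ) {t : ℝ} (ht : t ∈ Icc (0 : ℝ) 1) :
    Tendsto (fun t' => relDist S (γ t) (γ t') / |t' - t|) (𝓝[Icc 0 1 \ {t}] t)
      (𝓝 (2 * speed S γ t)) := by
  have hQ : Tendsto (fun t' => (Matrix.of fun i j => slope (fun u => gram S (γ u) i j) t t' :
      Matrix (Fin (N + 1)) (Fin (N + 1)) ℂ)) (𝓝[Icc 0 1 \ {t}] t) (𝓝 (gramDeriv S γ t)) := by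
    refine tendsto_pi_nhds.mpr fun i => tendsto_pi_nhds.mpr fun j => ?_
    exact hasDerivWithinAt_iff_tendsto_slope.mp
      (((hγ.2.2 i j).differentiableOn one_ne_zero) t ht).hasDerivWithinAt
  have h2 : 2 * speed S γ t
      = Real.sqrt (Matrix.trace (((gram S (γ t))⁻¹ * gramDeriv S γ t) ^ 2)).re := by
    rw [speed]; ring
  rw [h2]
  refine (continuous_sqrt_re_trace_sq.continuousAt.tendsto.comp
    ((tendsto_const_nhds (x := (gram S (γ t))⁻¹)).mul hQ)).congr' ?_
  filter_upwards [self_mem_nhdsWithin] with t' ht'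
  have hne : t' - t ≠ 0 := sub_ne_zero.mpr ht'.2
  have hQe : gram S (γ t') - gram S (γ t) = (((t' - t : ℝ)) : ℂ) •
      (Matrix.of fun i j => slope (fun u => gram S (γ u) i j) t t' :
        Matrix (Fin (N + 1)) (Fin (N + 1)) ℂ) := by
    ext i j
    rw [Matrix.smul_apply, Matrix.of_apply, slope_def_module, Complex.real_smul, smul_eq_mul,
      ← mul_assoc, ← Complex.ofReal_mul, mul_inv_cancel₀ hne, Complex.ofReal_one, one_mul,
      Matrix.sub_apply]
  rw [relDist, hQe, Matrix.mul_smul, smul_pow, Matrix.trace_smul, smul_eq_mul,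
    ← Complex.ofReal_pow, Complex.re_ofReal_mul, Real.sqrt_mul (sq_nonneg _), Real.sqrt_sq_eq_abs,
    mul_div_cancel_left₀ _ (abs_ne_zero.mpr hne)]
  rfl

/-- The loss in the one-step comparison is d(1 + 2d)/(1 - d), where d → 0 and d/|t' - t| tends to
2·speed. -/
theorem IsC1Path.eventually_relDist_le (hγ : IsC1Path S b₀ b₁ γ) {t c : ℝ}
    (ht : t ∈ Icc (0 : ℝ) 1) (hc : 2 * speed S γ t < c) :
    ∀ᶠ t' in 𝓝[Icc 0 1] t,
      (relDist S (γ t) (γ t') + 2 * relDist S (γ t) (γ t') ^ 2) / (1 - relDist S (γ t) (γ t'))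
        ≤ c * |t' - t| := by
  have h0 := (hγ.tendsto_relDist_right ht).mono_left
    (nhdsWithin_mono t (sdiff_subset (s := Icc (0 : ℝ) 1) (t := {t})))
  have h1 := (hγ.tendsto_relDist_div ht).mul
    (((h0.const_mul 2).const_add 1).div (h0.const_sub 1) (by norm_num))
  have e : 2 * speed S γ t * ((1 + 2 * 0) / (1 - 0)) = 2 * speed S γ t := by ring
  rw [e] at h1
  have h2 := h1.eventually (gt_mem_nhds hc)
  rw [eventually_nhdsWithin_iff] at h2 ⊢
  filter_upwards [h2] with t' h3 ht'
  rcases eq_or_ne t' t with rfl | hne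
  · simp [relDist_self]
  have h4 := h3 ⟨ht', hne⟩
  have hpos : 0 < |t' - t| := abs_pos.mpr (sub_ne_zero.mpr hne)
  have h5 := (mul_lt_mul_of_pos_right h4 hpos).le
  refine le_trans (le_of_eq ?_) h5
  simp only [Pi.div_apply]
  field_simp

/-- The convex combination of two Hermitian inner products. -/
noncomputable abbrev mix (b₀ b₁ : Space V) (t : ℝ) (ht : t ∈ Icc (0 : ℝ) 1) : Space V where
  inner x y := ((1 - t : ℝ) : ℂ) * b₀.inner x y + (t : ℂ) * b₁.inner x y
  conj_inner_symm x y := by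
    rw [map_add, map_mul, map_mul, b₀.conj_inner_symm, b₁.conj_inner_symm, Complex.conj_ofReal,
      Complex.conj_ofReal]
  re_inner_nonneg x := by
    have h0 := b₀.re_inner_nonneg x
    have h1 := b₁.re_inner_nonneg x
    simp only [RCLike.re_to_complex, Complex.add_re, Complex.re_ofReal_mul] at h0 h1 ⊢
    exact add_nonneg (mul_nonneg (by linarith [ht.2]) h0) (mul_nonneg ht.1 h1)
  add_left x y z := by rw [b₀.add_left, b₁.add_left]; ring
  smul_left x y r := by rw [b₀.smul_left, b₁.smul_left]; ring
  definite x hx := by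
    have h0 := b₀.re_inner_nonneg x
    have h1 := b₁.re_inner_nonneg x
    have hre := congrArg Complex.re hx
    simp only [RCLike.re_to_complex] at h0 h1
    simp only [Complex.add_re, Complex.re_ofReal_mul, Complex.zero_re] at hre
    have hdef : ∀ b : Space V, (b.inner x x).re = 0 → x = 0 := fun b hb =>
      b.definite x (Complex.ext hb (by
        have h := congrArg Complex.im (b.conj_inner_symm x x)
        rw [Complex.conj_im] at h
        simp only [Complex.zero_im]
        linarith))
    rcases ht.1.eq_or_lt with h | h
    · subst h
      exact hdef b₀ (by linarith)
    · refine hdef b₁ ?_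
      have h2 : 0 ≤ (1 - t) * (b₀.inner x x).re := mul_nonneg (by linarith [ht.2]) h0
      have h3 : t * (b₁.inner x x).re = 0 :=
        le_antisymm (by linarith) (mul_nonneg ht.1 h1)
      exact (mul_eq_zero.mp h3).resolve_left h.ne'

open Classical in
/-- The straight segment between two Hermitian inner products. -/
noncomputable abbrev straightPath (b₀ b₁ : Space V) (t : ℝ) : Space V :=
  if t = 0 then b₀ else if t = 1 then b₁ else
    if h : t ∈ Icc (0 : ℝ) 1 then mix b₀ b₁ t h else b₀

/-- Without a curve the infimum would be `sInf ∅ = 0` and would carry no information. -/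
theorem exists_isC1Path (S : Module.Basis (Fin (N + 1)) ℂ V) (b₀ b₁ : Space V) :
    ∃ γ, IsC1Path S b₀ b₁ γ := by
  have h0 : straightPath b₀ b₁ 0 = b₀ := if_pos rfl
  have h1 : straightPath b₀ b₁ 1 = b₁ := by rw [straightPath, if_neg one_ne_zero, if_pos rfl]
  refine ⟨straightPath b₀ b₁, h0, h1, fun i j => ?_⟩
  have hc : ContDiff ℝ 1 fun t : ℝ =>
      ((1 - t : ℝ) : ℂ) * gram S b₀ i j + (t : ℂ) * gram S b₁ i j := by
    have h1 : ContDiff ℝ 1 fun t : ℝ => ((1 - t : ℝ) : ℂ) :=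
      Complex.ofRealCLM.contDiff.comp (contDiff_const.sub contDiff_id)
    have h2 : ContDiff ℝ 1 fun t : ℝ => (t : ℂ) := Complex.ofRealCLM.contDiff
    exact (h1.mul contDiff_const).add (h2.mul contDiff_const)
  refine hc.contDiffOn.congr fun t ht => ?_
  rcases eq_or_ne t 0 with rfl | ht0
  · rw [h0]; simp
  rcases eq_or_ne t 1 with rfl | ht1
  · rw [h1]; simp
  rw [straightPath, if_neg ht0, if_neg ht1, dif_pos ht]
  rfl

end Paths

/-! ### Integration along a curve -/

section Main

open Matrix Set Filter Topology

variable {n : ℕ} {M : Type*} [TopologicalSpace M] [MeasurableSpace M] [BorelSpace M]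
  [ChartedSpace (EuclideanSpace ℂ (Fin n)) M] (Ω : Measure M) [IsFiniteMeasure Ω]
  {L : M → Type*} [∀ p, AddCommGroup (L p)] [∀ p, Module ℂ (L p)]
  [TopologicalSpace (Bundle.TotalSpace ℂ L)] [∀ p, TopologicalSpace (L p)]
  [FiberBundle ℂ L] [VectorBundle ℂ ℂ L] {k N : ℕ}

theorem opNorm_nonneg (A : Matrix (Fin (N + 1)) (Fin (N + 1)) ℂ) : 0 ≤ opNorm A := norm_nonneg _

/-- Unitary invariance: the one-step comparison at relative distance 0, in both directions. -/
theorem opNorm_momentIntegral_congr (hL : GloballyGenerated (n := n) L k)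
    {b : Space (H0 (n := n) L k)} {s s' : Module.Basis (Fin (N + 1)) ℂ (H0 (n := n) L k)}
    (h : IsOrthonormalBasis b s) (h' : IsOrthonormalBasis b s') :
    opNorm (momentIntegral Ω (kodairaMap hL s)) = opNorm (momentIntegral Ω (kodairaMap hL s')) := by
  refine le_antisymm ?_ ?_
  · simpa [relDist_self] using opNorm_momentIntegral_comparison Ω hL s h h' (by simp [relDist_self])
  · simpa [relDist_self] using opNorm_momentIntegral_comparison Ω hL s h' h (by simp [relDist_self])

theorem opNorm_momentIntegral_le_of_path (hL : GloballyGenerated (n := n) L k)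
    {S : Module.Basis (Fin (N + 1)) ℂ (H0 (n := n) L k)} {b₀ b₁ : Space (H0 (n := n) L k)}
    {γ : ℝ → Space (H0 (n := n) L k)} (hγ : IsC1Path S b₀ b₁ γ)
    {s₀ s₁ : Module.Basis (Fin (N + 1)) ℂ (H0 (n := n) L k)}
    (h₀ : IsOrthonormalBasis b₀ s₀) (h₁ : IsOrthonormalBasis b₁ s₁) :
    opNorm (momentIntegral Ω (kodairaMap hL s₁)) ≤
      Real.exp (2 * ∫ t in (0 : ℝ)..1, speed S γ t)
        * opNorm (momentIntegral Ω (kodairaMap hL s₀)) := by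
  choose s hs using fun t => exists_isOrthonormalBasis S (γ t)
  set m : ℝ → ℝ := fun t => opNorm (momentIntegral Ω (kodairaMap hL (s t)))
  have hm0 : ∀ t, 0 ≤ m t := fun t => opNorm_nonneg _
  have e0 : opNorm (momentIntegral Ω (kodairaMap hL s₀)) = m 0 :=
    opNorm_momentIntegral_congr Ω hL h₀ (hγ.1 ▸ hs 0)
  have e1 : opNorm (momentIntegral Ω (kodairaMap hL s₁)) = m 1 :=
    opNorm_momentIntegral_congr Ω hL h₁ (hγ.2.1 ▸ hs 1)
  rw [e0, e1]
  rcases (hm0 1).eq_or_lt with hz | hpos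
  · rw [← hz]; exact mul_nonneg (Real.exp_pos _).le (hm0 0)
  have hcmp : ∀ t t', relDist S (γ t) (γ t') ≤ 1 / 2 →
      (1 - (relDist S (γ t) (γ t') + 2 * relDist S (γ t) (γ t') ^ 2)
        / (1 - relDist S (γ t) (γ t'))) * m t ≤ m t' := fun t t' h =>
    opNorm_momentIntegral_comparison Ω hL S (hs t) (hs t') h
  have hlim : ∀ {l : Filter ℝ} {d : ℝ → ℝ}, Tendsto d l (𝓝 0) →
      Tendsto (fun t => 1 - (d t + 2 * d t ^ 2) / (1 - d t)) l (𝓝 1) := by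
    intro l d hd
    have := ((hd.add ((hd.pow 2).const_mul 2)).div (hd.const_sub 1) (by norm_num)).const_sub 1
    simpa using this
  -- The bases `s t` are chosen without any continuity in t; m is squeezed between the comparisons
  -- from t to t' and from t' to t.
  have hm : ContinuousOn m (Icc 0 1) := by
    intro t ht
    have hr := hγ.tendsto_relDist_right ht
    have hl := hγ.tendsto_relDist_left ht
    have hlow : Tendsto _ (𝓝[Icc 0 1] t) (𝓝 (1 * m t)) := (hlim hr).mul_const (m t)
    have hup : Tendsto _ (𝓝[Icc 0 1] t) (𝓝 (m t / 1)) :=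
      (tendsto_const_nhds (x := m t)).div (hlim hl) one_ne_zero
    rw [one_mul] at hlow
    rw [div_one] at hup
    refine tendsto_of_tendsto_of_tendsto_of_le_of_le' hlow hup ?_ ?_
    · filter_upwards [hr (Iic_mem_nhds (show (0 : ℝ) < 1 / 2 by norm_num))] with t' h
      exact hcmp t t' h
    · filter_upwards [hl (Iic_mem_nhds (show (0 : ℝ) < 1 / 2 by norm_num)),
        (hlim hl).eventually (lt_mem_nhds (a := 0) one_pos)] with t' h hp
      simp only [Pi.div_apply]
      rw [le_div_iff₀ hp, mul_comm]
      exact hcmp t' t h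
  -- Extended by constants, so that the rate is continuous on the whole line.
  set σ : ℝ → ℝ := IccExtend zero_le_one ((Icc (0 : ℝ) 1).domRestrict fun t => 2 * speed S γ t)
  have hσ : Continuous σ :=
    (continuousOn_iff_continuous_domRestrict.mp
      (continuousOn_const.mul hγ.continuousOn_speed)).Icc_extend'
  have hσe : ∀ t ∈ Icc (0 : ℝ) 1, σ t = 2 * speed S γ t := fun t ht =>
    IccExtend_of_mem zero_le_one _ ht
  have hint : ∫ t in (0 : ℝ)..1, σ t = 2 * ∫ t in (0 : ℝ)..1, speed S γ t := by
    rw [← intervalIntegral.integral_const_mul]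
    refine intervalIntegral.integral_congr fun t ht => ?_
    rw [uIcc_of_le zero_le_one] at ht
    exact hσe t ht
  rw [← hint]
  refine le_exp_integral_mul hm hσ hpos fun t ht c hc => ?_
  rw [hσe t ht] at hc
  filter_upwards [hγ.eventually_relDist_le ht hc, hγ.tendsto_relDist_right ht
    (Iic_mem_nhds (show (0 : ℝ) < 1 / 2 by norm_num))] with t' h1 h2
  exact (mul_le_mul_of_nonneg_right (by linarith) (hm0 t)).trans (hcmp t t' h2)

end Main

end Bergman

theorem mainTheorem9 {n : ℕ} {M : Type*} [TopologicalSpace M] [T2Space M] [CompactSpace M]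
    [MeasurableSpace M] [BorelSpace M]
    [ChartedSpace (EuclideanSpace ℂ (Fin n)) M]
    [IsManifold 𝓘(ℂ, EuclideanSpace ℂ (Fin n)) ω M]
    (Ω : Measure M) [IsFiniteMeasure Ω]
    (L : M → Type*) [∀ p, AddCommGroup (L p)] [∀ p, Module ℂ (L p)]
    [TopologicalSpace (Bundle.TotalSpace ℂ L)] [∀ p, TopologicalSpace (L p)]
    [FiberBundle ℂ L] [VectorBundle ℂ ℂ L]
    [ContMDiffVectorBundle ω ℂ L 𝓘(ℂ, EuclideanSpace ℂ (Fin n))]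
    (k N : ℕ) (hL : Bergman.GloballyGenerated (n := n) L k)
    (S : Module.Basis (Fin (N + 1)) ℂ (Bergman.H0 (n := n) L k))
    (b₀ b₁ : Bergman.Space (Bergman.H0 (n := n) L k))
    (s₀ s₁ : Module.Basis (Fin (N + 1)) ℂ (Bergman.H0 (n := n) L k))
    (h₀ : Bergman.IsOrthonormalBasis b₀ s₀) (h₁ : Bergman.IsOrthonormalBasis b₁ s₁) :
    Bergman.opNorm (Bergman.momentIntegral Ω (Bergman.kodairaMap hL s₁)) ≤
      Real.exp (2 * Bergman.dist S b₀ b₁) *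
        Bergman.opNorm (Bergman.momentIntegral Ω (Bergman.kodairaMap hL s₀)) := by
  have hne : {ℓ : ℝ | ∃ γ, Bergman.IsC1Path S b₀ b₁ γ ∧
      ℓ = ∫ t in (0 : ℝ)..1, Bergman.speed S γ t}.Nonempty := by
    obtain ⟨γ, hγ⟩ := Bergman.exists_isC1Path S b₀ b₁
    exact ⟨_, γ, hγ, rfl⟩
  set m₀ := Bergman.opNorm (Bergman.momentIntegral Ω (Bergman.kodairaMap hL s₀))
  set m₁ := Bergman.opNorm (Bergman.momentIntegral Ω (Bergman.kodairaMap hL s₁))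
  have hpath : ∀ ℓ ∈ {ℓ : ℝ | ∃ γ, Bergman.IsC1Path S b₀ b₁ γ ∧
      ℓ = ∫ t in (0 : ℝ)..1, Bergman.speed S γ t}, m₁ ≤ Real.exp (2 * ℓ) * m₀ := by
    rintro _ ⟨γ, hγ, rfl⟩
    exact Bergman.opNorm_momentIntegral_le_of_path Ω hL hγ h₀ h₁
  have hm₀ : 0 ≤ m₀ := Bergman.opNorm_nonneg _
  have hm₁ : 0 ≤ m₁ := Bergman.opNorm_nonneg _
  rcases hm₁.eq_or_lt with hz | hpos
  · rw [← hz]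
    exact mul_nonneg (Real.exp_pos _).le hm₀
  have hpos₀ : 0 < m₀ := by
    obtain ⟨ℓ, hℓ⟩ := hne
    exact pos_of_mul_pos_right (hpos.trans_le (hpath ℓ hℓ)) (Real.exp_pos _).le
  -- Taking logarithms makes the bound a lower bound for every length, hence for their infimum,
  -- which need not be attained.
  have hle : Real.log (m₁ / m₀) / 2 ≤ Bergman.dist S b₀ b₁ := by
    refine le_csInf hne fun ℓ hℓ => ?_
    rw [div_le_iff₀ two_pos, Real.log_le_iff_le_exp (div_pos hpos hpos₀), div_le_iff₀ hpos₀,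
      mul_comm ℓ]
    exact hpath ℓ hℓ
  rwa [div_le_iff₀ two_pos, Real.log_le_iff_le_exp (div_pos hpos hpos₀), div_le_iff₀ hpos₀,
    mul_comm (Bergman.dist S b₀ b₁)] at hle
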